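/- All graphs are finite and simple. For a tree $T$ let $|T|$ be its number of vertices, $\alpha(T)$ its stability number (the largest size of a set of pairwise non-adjacent vertices) and $F(T)$ its number of stable sets, including the empty set. A tree $T$ is extremal if $F(T)\le F(T')$ for every tree $T'$ with $|T'|=|T|$ and $\alpha(T')=\alpha(T)$. A leaf is a vertex of degree at most $1$. Trees of stars are defined inductively: a single vertex is a tree of stars; and if $T_1,\dots,T_k$ ($k\ge 2$) are disjoint trees of stars and $v_i$ is a leaf of $T_i$, then the tree obtained from $T_1\cup\dots\cup T_k$ by adding a new vertex adjacent to exactly $v_1,\dots,v_k$ is a tree of stars. A center of a tree of stars is a vertex whose distances to all leaves are odd. A tree of stars is balanced if the degrees of any two of its centers differ by at most $1$. An odd path is a path with an odd number of edges. Theorem. Let $T$ be an extremal tree, $n=|T|$ and $\alpha=\alpha(T)$. Then $T$ is either a balanced tree of stars or an odd path. Moreover, if $n\ge 2$, the edges of $T$ can be partitioned into $n-\alpha$ stars, each having $\lceil\frac{n-1}{n-\alpha}\rceil$ or $\lfloor\frac{n-1}{n-\alpha}\rfloor$ edges, such that every vertex of $T$ lies in at most two of these stars and the centers of these stars form a stable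 set of $T$ (in a star with a single edge, either end may be taken as its center). If in addition $T$ is not an odd path, this partition is unique. -/

import Mathlib

namespace StableTree

/-- The Fibonacci number `F(G)`: the number of stable sets of `G`, the empty set included. -/
noncomputable def fibNumber {V : Type*} (G : SimpleGraph V) : ℕ :=
  {S : Set V | G.IsIndepSet S}.ncard

/-- `T` is a tree with minimum Fibonacci number among all trees of the same order and the same
stability number (every tree of order `|V|` has a copy on the vertex set `V`). -/
def IsExtremalTree {V : Type*} (T : SimpleGraph V) : Prop :=
  T.IsTree ∧ ∀ T' : SimpleGraph V, T'.IsTree → T'.indepNum = T.indepNum →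
    fibNumber T ≤ fibNumber T'

/-- `v` is a leaf of the subgraph of `G` induced by `S`: a vertex of degree at most `1`. -/
def IsLeafOn {V : Type*} (G : SimpleGraph V) (S : Set V) (v : V) : Prop :=
  v ∈ S ∧ (G.neighborSet v ∩ S).ncard ≤ 1

/-- `IsTreeOfStarsOn G S`: the subgraph of `G` induced by `S` is a tree of stars. Either it is a
single vertex, or it arises from `k ≥ 2` disjoint trees of stars (on the sets `S i`, with no edges
between different ones) by adding a new vertex `w` that is adjacent to one leaf `v i` of each. -/
inductive IsTreeOfStarsOn {V : Type*} (G : SimpleGraph V) : Set V → Prop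
  | single (v : V) : IsTreeOfStarsOn G {v}
  | join (k : ℕ) (hk : 2 ≤ k) (S : Fin k → Set V) (v : Fin k → V) (w : V)
      (hS : ∀ i, IsTreeOfStarsOn G (S i))
      (hdisj : ∀ i j, i ≠ j → Disjoint (S i) (S j))
      (hsep : ∀ i j, i ≠ j → ∀ x ∈ S i, ∀ y ∈ S j, ¬ G.Adj x y)
      (hleaf : ∀ i, IsLeafOn G (S i) (v i))
      (hw : ∀ i, w ∉ S i)
      (hadj : ∀ i, ∀ x ∈ S i, G.Adj w x ↔ x = v i) :
      IsTreeOfStarsOn G (insert w (⋃ i, S i))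

/-- `T` is a tree of stars. -/
def IsTreeOfStars {V : Type*} (T : SimpleGraph V) : Prop :=
  IsTreeOfStarsOn T Set.univ

/-- `v` is a center: its distances to all leaves (vertices of degree at most `1`) are odd. -/
def IsCenter {V : Type*} (T : SimpleGraph V) (v : V) : Prop :=
  ∀ u : V, (T.neighborSet u).ncard ≤ 1 → Odd (T.dist v u)

/-- A tree of stars is balanced if the degrees of any two of its centers differ by at most `1`. -/
def IsBalancedTreeOfStars {V : Type*} (T : SimpleGraph V) : Prop :=
  IsTreeOfStars T ∧ ∀ u v : V, IsCenter T u → IsCenter T v →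
    (T.neighborSet u).ncard ≤ (T.neighborSet v).ncard + 1

/-- `T` is a path of odd length, the length being the number of edges. -/
def IsOddPath {V : Type*} (T : SimpleGraph V) : Prop :=
  ∃ l : ℕ, Odd l ∧ Nonempty (T ≃g SimpleGraph.pathGraph (l + 1))

/-- The nonempty set `E` of edges of a simple graph forms a star with center `c`. -/
def IsStarAt {V : Type*} (E : Set (Sym2 V)) (c : V) : Prop :=
  E.Nonempty ∧ ∀ e ∈ E, c ∈ e

/-- `P` partitions the edges of `T` into `n - α` stars of sizes `⌈(n-1)/(n-α)⌉` or
`⌊(n-1)/(n-α)⌋`, where `n = |T|` and `α = α(T)`, such that every vertex lies in at most two of the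
stars and such that the centers of the stars form a stable set. (In a star with one edge
either end may serve as the center.) -/
structure IsBalancedStarPartition {V : Type*} (T : SimpleGraph V) (P : Set (Set (Sym2 V))) :
    Prop where
  cover : ⋃₀ P = T.edgeSet
  disjoint : ∀ E ∈ P, ∀ E' ∈ P, E ≠ E' → Disjoint E E'
  count : (P.ncard : ℤ) = (Nat.card V : ℤ) - (T.indepNum : ℤ)
  size : ∀ E ∈ P,
    (E.ncard : ℤ) = ⌈((Nat.card V : ℚ) - 1) / ((Nat.card V : ℚ) - (T.indepNum : ℚ))⌉ ∨
    (E.ncard : ℤ) = ⌊((Nat.card V : ℚ) - 1) / ((Nat.card V : ℚ) - (T.indepNum : ℚ))⌋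
  atMostTwo : ∀ v : V, {E ∈ P | ∃ e ∈ E, v ∈ e}.ncard ≤ 2
  centers : ∃ c : Set (Sym2 V) → V, (∀ E ∈ P, IsStarAt E (c E)) ∧ T.IsIndepSet (c '' P)

end StableTree

/-! ### Rooted forests and the recursions for counting stable sets. -/

namespace StableTree

/-! Root the tree and call a vertex of type E if none of its children is of type E. These vertices
form a maximum stable set, so `ess` computes the stability number, and the number of stable sets
obeys an equally simple recursion.

All exchanges rest on one computation. Suppose a branch X hanging from x is moved to y, and let
#(..) count stable sets of the rest of the tree. The number of stable sets drops by (`X.tot -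
X.out`) * (#(y in, x out) - #(x in, y out)). As `X.out < X.tot`, an optimal tree satisfies #(y in, x
out) ≤ #(x in, y out) for every move that preserves the stability number.

Types being taken with respect to the root, three uses of this determine the tree. A root of degree
at least 3 has no two children outside type E (`not_opt_of_hasE_of_hasE`: branches go to a far leaf
or to its neighbour). Nor does it have children of both kinds (`not_opt_of_hasE_of_not_hasE`: a
branch goes to a leaf at even distance below the child of type E, where comparison with a path gives
the inequality). So all its children are of type E, and after rerooting the tree alternates between
vertices of degree at most 2 and centers. Finally, the center degrees cannot differ by 2 or more
(`not_opt_of_innerVertex`: a branch moves from a center of large degree to one of small degree).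

`Opt.exists_alt` collects this, and `Represents` carries it over to graphs. The stars of the
partition are the edge sets at the vertices of even depth, counted from the root. In any other such
partition the centers would form the opposite colour class, which has too many vertices unless the
tree is an odd path. -/

/-- Rooted labelled forests: `cons v c s` is the tree with root `v` and forest of children `c`,
followed by the forest `s`. -/
inductive Forest (V : Type*) : Type _
  | nil : Forest V
  | cons (v : V) (c s : Forest V) : Forest V

namespace Forest

variable {V : Type*}

/-- Juxtaposition of two forests. -/
def append : Forest V → Forest V → Forest V
  | nil, t => t
  | cons v c s, t => cons v c (append s t)

/-- The multiset of vertices. -/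
def labels : Forest V → Multiset V
  | nil => 0
  | cons v c s => v ::ₘ (labels c + labels s)

/-- The multiset of edges after joining all roots to a vertex `p`. -/
def edges : V → Forest V → Multiset (Sym2 V)
  | _, nil => 0
  | p, cons v c s => s(p, v) ::ₘ (edges v c + edges p s)

/-- The number of trees. -/
def len : Forest V → ℕ
  | nil => 0
  | cons _ _ s => len s + 1

/-- The pair consisting of the number of stable sets and the number of stable sets without
roots. -/
def counts : Forest V → ℕ × ℕ
  | nil => (1, 1)
  | cons _ c s => (((counts c).1 + (counts c).2) * (counts s).1, (counts c).1 * (counts s).2)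

/-- The number of stable sets. -/
def tot (f : Forest V) : ℕ := f.counts.1

/-- The number of stable sets that contain no root. -/
def out (f : Forest V) : ℕ := f.counts.2

/-- Some tree of the forest has its root in all of its maximum stable sets: equivalently, no child
of that root has this property. -/
def hasE : Forest V → Bool
  | nil => false
  | cons _ c s => !hasE c || hasE s

/-- The number of vertices that lie in all maximum stable sets of the subtree below them. -/
def ess : Forest V → ℕ
  | nil => 0
  | cons _ c s => ess c + ess s + (bif hasE c then 0 else 1)

@[simp] theorem tot_nil : (nil : Forest V).tot = 1 := rfl
@[simp] theorem out_nil : (nil : Forest V).out = 1 := rfl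
@[simp] theorem tot_cons (v : V) (c s : Forest V) :
    (cons v c s).tot = (c.tot + c.out) * s.tot := rfl
@[simp] theorem out_cons (v : V) (c s : Forest V) : (cons v c s).out = c.tot * s.out := rfl
@[simp] theorem hasE_nil : (nil : Forest V).hasE = false := rfl
@[simp] theorem hasE_cons (v : V) (c s : Forest V) :
    (cons v c s).hasE = (!c.hasE || s.hasE) := rfl
@[simp] theorem ess_nil : (nil : Forest V).ess = 0 := rfl
@[simp] theorem ess_cons (v : V) (c s : Forest V) :
    (cons v c s).ess = c.ess + s.ess + (bif c.hasE then 0 else 1) := rfl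
@[simp] theorem labels_nil : (nil : Forest V).labels = 0 := rfl
@[simp] theorem labels_cons (v : V) (c s : Forest V) :
    (cons v c s).labels = v ::ₘ (c.labels + s.labels) := rfl
@[simp] theorem edges_nil (p : V) : (nil : Forest V).edges p = 0 := rfl
@[simp] theorem edges_cons (p v : V) (c s : Forest V) :
    (cons v c s).edges p = s(p, v) ::ₘ (c.edges v + s.edges p) := rfl
@[simp] theorem len_nil : (nil : Forest V).len = 0 := rfl
@[simp] theorem len_cons (v : V) (c s : Forest V) : (cons v c s).len = s.len + 1 := rfl
@[simp] theorem nil_append (t : Forest V) : nil.append t = t := rfl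
@[simp] theorem cons_append (v : V) (c s t : Forest V) :
    (cons v c s).append t = cons v c (s.append t) := rfl

@[simp] theorem append_nil (f : Forest V) : f.append nil = f := by
  induction f with
  | nil => rfl
  | cons v c s _ ih => simp [ih]

theorem append_assoc (f g h : Forest V) : (f.append g).append h = f.append (g.append h) := by
  induction f with
  | nil => rfl
  | cons v c s _ ih => simp [ih]

@[simp] theorem tot_append (f g : Forest V) : (f.append g).tot = f.tot * g.tot := by
  induction f with
  | nil => simp
  | cons v c s _ ih => simp [ih, mul_assoc]

@[simp] theorem out_append (f g : Forest V) : (f.append g).out = f.out * g.out := by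
  induction f with
  | nil => simp
  | cons v c s _ ih => simp [ih, mul_assoc]

@[simp] theorem hasE_append (f g : Forest V) : (f.append g).hasE = (f.hasE || g.hasE) := by
  induction f with
  | nil => simp
  | cons v c s _ ih => simp [ih, Bool.or_assoc]

@[simp] theorem ess_append (f g : Forest V) : (f.append g).ess = f.ess + g.ess := by
  induction f with
  | nil => simp
  | cons v c s _ ih => simp [ih]; ring

@[simp] theorem labels_append (f g : Forest V) :
    (f.append g).labels = f.labels + g.labels := by
  induction f with
  | nil => simp
  | cons v c s _ ih => simp [ih, add_assoc]

@[simp] theorem edges_append (p : V) (f g : Forest V) :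
    (f.append g).edges p = f.edges p + g.edges p := by
  induction f with
  | nil => simp
  | cons v c s _ ih => simp [ih, add_assoc]

@[simp] theorem len_append (f g : Forest V) : (f.append g).len = f.len + g.len := by
  induction f with
  | nil => simp
  | cons v c s _ ih => simp [ih]; ring

theorem tot_pos (f : Forest V) : 0 < f.tot := by
  induction f with
  | nil => simp
  | cons v c s ihc ihs => simp only [tot_cons]; positivity

theorem out_pos (f : Forest V) : 0 < f.out := by
  induction f with
  | nil => simp
  | cons v c s ihc ihs => have := tot_pos c; simp only [out_cons]; positivity

theorem out_le_tot (f : Forest V) : f.out ≤ f.tot := by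
  induction f with
  | nil => simp
  | cons v c s ihc ihs =>
    simp only [tot_cons, out_cons]
    exact Nat.mul_le_mul (Nat.le_add_right _ _) ihs

theorem out_lt_tot {f : Forest V} (hf : f ≠ nil) : f.out < f.tot := by
  cases f with
  | nil => exact absurd rfl hf
  | cons v c s =>
    simp only [tot_cons, out_cons]
    have h1 := out_le_tot s
    have h2 := out_pos c
    have h3 := tot_pos s
    nlinarith [tot_pos c]

/-! ### Optimality and rerooting. -/

/-- The tree with root `r` and children `f` has the fewest stable sets among all trees with the
same vertices and the same stability number. -/
def Opt (r : V) (f : Forest V) : Prop :=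
  ∀ r' f', (cons r' f' nil).labels = (cons r f nil).labels →
    (cons r' f' nil).ess = (cons r f nil).ess → (cons r f nil).tot ≤ (cons r' f' nil).tot

/-- Two rooted trees that are the same as unrooted trees. -/
structure Same (r : V) (f : Forest V) (r' : V) (f' : Forest V) : Prop where
  labels : (cons r f nil).labels = (cons r' f' nil).labels
  edges : f.edges r = f'.edges r'
  ess : (cons r f nil).ess = (cons r' f' nil).ess
  tot : (cons r f nil).tot = (cons r' f' nil).tot

theorem Same.trans {r r' r'' : V} {f f' f'' : Forest V} (h : Same r f r' f')
    (h' : Same r' f' r'' f'') : Same r f r'' f'' :=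
  ⟨h.labels.trans h'.labels, h.edges.trans h'.edges, h.ess.trans h'.ess, h.tot.trans h'.tot⟩

theorem Same.refl (r : V) (f : Forest V) : Same r f r f := ⟨rfl, rfl, rfl, rfl⟩

theorem Opt.congr {r r' : V} {f f' : Forest V} (h : Opt r f) (hs : Same r f r' f') :
    Opt r' f' := by
  intro r'' f'' h1 h2
  rw [← hs.tot]
  exact h r'' f'' (h1.trans hs.labels.symm) (h2.trans hs.ess.symm)

theorem same_append_comm (r : V) (f g : Forest V) : Same r (f.append g) r (g.append f) := by
  refine ⟨?_, ?_, ?_, ?_⟩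
  · simp [add_comm]
  · simp [add_comm]
  · simp [add_comm, Bool.or_comm]
  · simp [mul_comm]

theorem same_move (r v : V) (c f g : Forest V) :
    Same r (cons v c (f.append g)) r (f.append (cons v c g)) := by
  refine ⟨?_, ?_, ?_, ?_⟩
  · simp [add_left_comm]
  · simp [add_left_comm]
  · cases hc : c.hasE <;> simp [hc] <;> ring
  · simp; ring

/-- Only the two ends of the edge can change type. Before and after, exactly one of them is of type
E, unless both `c` and `s` have a root of type E, when neither is. -/
theorem same_reroot (r v : V) (c s : Forest V) :
    Same r (cons v c s) v (c.append (cons r s nil)) := by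
  refine ⟨?_, ?_, ?_, ?_⟩
  · simp only [labels_cons, labels_append, labels_nil, add_zero]
    rw [Multiset.add_cons, Multiset.cons_swap]
  · simp [Sym2.eq_swap]
  · cases hc : c.hasE <;> cases hs : s.hasE <;> simp [hc, hs] <;> ring
  · simp; ring

/-! ### First exchange: two neighbours that are not of type E. -/

/-- A leaf `l` of the forest `f`, with neighbour `z`, at odd distance from a vertex `a` joined to
all roots. The numbers `p₀, p₁` count the stable sets of `f` avoiding, respectively containing `l`,
and `q₀, q₁` count those without roots. `graft X` joins the roots of `X` to `l`. Unless `z = a`,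
`sideGraft X` joins them to `z`. -/
structure OddLeaf (f : Forest V) where
  (p₀ p₁ q₀ q₁ u w : ℕ)
  graft : Forest V → Forest V
  labels_graft : ∀ X, (graft X).labels = f.labels + X.labels
  hasE_graft : ∀ X, X.hasE = false → (graft X).hasE = true
  ess_graft : ∀ X, (graft X).ess + (bif X.hasE then 1 else 0) = f.ess + X.ess
  tot_graft : ∀ X, (graft X).tot = p₀ * X.tot + p₁ * X.out
  out_graft : ∀ X, (graft X).out = q₀ * X.tot + q₁ * X.out
  tot_eq : f.tot = p₀ + p₁
  out_eq : f.out = q₀ + q₁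
  p₁_pos : 0 < p₁
  q₀_pos : 0 < q₀
  correlation : q₁ * p₀ ≤ q₀ * p₁
  p₀_eq : p₀ = p₁ + u
  q₀_eq : q₀ = q₁ + w
  side : (q₁ = 0 ∧ u = 0) ∨ ∃ sideGraft : Forest V → Forest V,
    (∀ X, (sideGraft X).labels = f.labels + X.labels) ∧
    (∀ X, (sideGraft X).hasE = true) ∧
    (∀ X, (sideGraft X).ess = f.ess + X.ess) ∧
    (∀ X, (sideGraft X).tot = 2 * p₁ * X.tot + u * X.out) ∧
    (∀ X, (sideGraft X).out = 2 * q₁ * X.tot + w * X.out)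

/-- The leaf is the first root. -/
def OddLeaf.root (v : V) (s : Forest V) : OddLeaf (cons v nil s) where
  p₀ := s.tot
  p₁ := s.tot
  q₀ := s.out
  q₁ := 0
  u := 0
  w := s.out
  graft X := cons v X s
  labels_graft X := by simp [add_comm]
  hasE_graft X hX := by simp [hX]
  ess_graft X := by cases h : X.hasE <;> simp [h] <;> ring
  tot_graft X := by simp; ring
  out_graft X := by simp; ring
  tot_eq := by simp; ring
  out_eq := by simp
  p₁_pos := s.tot_pos
  q₀_pos := s.out_pos
  correlation := by simp
  p₀_eq := rfl
  q₀_eq := by simp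
  side := Or.inl ⟨rfl, rfl⟩

/-- The leaf is not in the first tree. -/
def OddLeaf.tail (v : V) (c : Forest V) {s : Forest V} (L : OddLeaf s) :
    OddLeaf (cons v c s) where
  p₀ := (c.tot + c.out) * L.p₀
  p₁ := (c.tot + c.out) * L.p₁
  q₀ := c.tot * L.q₀
  q₁ := c.tot * L.q₁
  u := (c.tot + c.out) * L.u
  w := c.tot * L.w
  graft X := cons v c (L.graft X)
  labels_graft X := by simp [L.labels_graft, add_assoc]
  hasE_graft X hX := by simp [L.hasE_graft X hX]
  ess_graft X := by
    have := L.ess_graft X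
    simp only [ess_cons]; omega
  tot_graft X := by simp [L.tot_graft]; ring
  out_graft X := by simp [L.out_graft]; ring
  tot_eq := by simp [L.tot_eq]; ring
  out_eq := by simp [L.out_eq]; ring
  p₁_pos := by have := L.p₁_pos; have := c.tot_pos; positivity
  q₀_pos := by have := L.q₀_pos; have := c.tot_pos; positivity
  correlation := by
    have := Nat.mul_le_mul_left (c.tot * (c.tot + c.out)) L.correlation
    linarith
  p₀_eq := by rw [L.p₀_eq]; ring
  q₀_eq := by rw [L.q₀_eq]; ring
  side := by
    rcases L.side with ⟨h1, h2⟩ | ⟨B, h1, h2, h3, h4, h5⟩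
    · exact Or.inl ⟨by simp [h1], by simp [h2]⟩
    · refine Or.inr ⟨fun X => cons v c (B X), fun X => ?_, fun X => ?_, fun X => ?_,
        fun X => ?_, fun X => ?_⟩
      · simp [h1, add_assoc]
      · simp [h2]
      · simp only [ess_cons, h3]; ring
      · simp [h4]; ring
      · simp [h5]; ring

/-- The leaf lies below the first child `b` of the first root `v`, and `v` has no child of
type `E`. -/
def OddLeaf.descend (v b : V) {g : Forest V} (t s : Forest V) (L : OddLeaf g)
    (hg : g.hasE = true) (ht : t.hasE = false) : OddLeaf (cons v (cons b g t) s) where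
  p₀ := ((L.p₀ + L.q₀) * t.tot + L.p₀ * t.out) * s.tot
  p₁ := ((L.p₁ + L.q₁) * t.tot + L.p₁ * t.out) * s.tot
  q₀ := (L.p₀ + L.q₀) * t.tot * s.out
  q₁ := (L.p₁ + L.q₁) * t.tot * s.out
  u := ((L.u + L.w) * t.tot + L.u * t.out) * s.tot
  w := (L.u + L.w) * t.tot * s.out
  graft X := cons v (cons b (L.graft X) t) s
  labels_graft X := by
    simp only [labels_cons, L.labels_graft, Multiset.cons_add]
    congr 2
    abel
  hasE_graft X hX := by simp [L.hasE_graft X hX, ht]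
  ess_graft X := by
    have h := L.ess_graft X
    cases hX : X.hasE <;> cases hgr : (L.graft X).hasE <;>
      simp [hX, hgr, hg, ht] at h ⊢ <;> omega
  tot_graft X := by simp [L.tot_graft, L.out_graft]; ring
  out_graft X := by simp [L.tot_graft, L.out_graft]; ring
  tot_eq := by simp [L.tot_eq, L.out_eq]; ring
  out_eq := by simp [L.tot_eq, L.out_eq]; ring
  p₁_pos := by
    have := L.p₁_pos; have := t.tot_pos; have := s.tot_pos; positivity
  q₀_pos := by
    have := L.q₀_pos; have := t.tot_pos; have := s.out_pos; positivity
  correlation := by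
    -- The difference `q₀ * p₁ - q₁ * p₀` gets multiplied by exactly this factor.
    have := Nat.mul_le_mul_left (t.tot * s.out * s.tot * t.out) L.correlation
    nlinarith
  p₀_eq := by rw [L.p₀_eq, L.q₀_eq]; ring
  q₀_eq := by rw [L.p₀_eq, L.q₀_eq]; ring
  side := by
    refine Or.inr ?_
    rcases L.side with ⟨h1, h2⟩ | ⟨B, h1, h2, h3, h4, h5⟩
    -- This case covers a leaf hanging directly from `b`: its neighbour is `b`, so `X` joins the
    -- children of `b`.
    · have hw := L.q₀_eq
      have hu := L.p₀_eq
      rw [h1, zero_add] at hw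
      rw [h2, add_zero] at hu
      refine ⟨fun X => cons v (cons b (X.append g) t) s, fun X => ?_, fun X => ?_, fun X => ?_,
        fun X => ?_, fun X => ?_⟩
      · simp only [labels_cons, labels_append, Multiset.cons_add]
        congr 2
        abel
      · simp [hg, ht]
      · simp [hg, ht]; ring
      · simp [L.tot_eq, L.out_eq, h1, h2, hu, hw]; ring
      · simp [L.tot_eq, L.out_eq, h1, h2, hu, hw]; ring
    · refine ⟨fun X => cons v (cons b (B X) t) s, fun X => ?_, fun X => ?_, fun X => ?_,
        fun X => ?_, fun X => ?_⟩
      · simp only [labels_cons, h1, Multiset.cons_add]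
        congr 2
        abel
      · simp [h2, ht]
      · simp [h2, h3, hg, ht]; ring
      · simp [h4, h5]; ring
      · simp [h4, h5]; ring

/-- A root of type E is a leaf, or its children are not of type E and so have a child of type E
themselves. Descending two levels at a time keeps the distance to `a` odd. -/
theorem exists_oddLeaf : ∀ f : Forest V, f.hasE = true → Nonempty (OddLeaf f)
  | nil, h => by simp at h
  | cons v nil s, _ => ⟨OddLeaf.root v s⟩
  | cons v (cons b g t) s, h => by
    by_cases hs : s.hasE = true
    · obtain ⟨L⟩ := exists_oddLeaf s hs
      exact ⟨L.tail v _⟩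
    · have h' : g.hasE = true ∧ t.hasE = false := by
        simpa [hs] using h
      obtain ⟨L⟩ := exists_oddLeaf g h'.1
      exact ⟨L.descend v b t s h'.1 h'.2⟩

/-- Take a leaf at odd distance below `a`. The first move yields `p₀ ≤ p₁ + 2 * q₁`, the second
bounds `p₀` from below. The two are incompatible because `a` and the leaf, at odd distance, are
negatively correlated. -/
theorem not_opt_of_le {v a b : V} {f g W : Forest V} (hW : W ≠ nil) (hf : f.hasE = true)
    (hg : g.hasE = true) (hle : f.out * g.tot ≤ g.out * f.tot) :
    ¬ Opt v (cons a f (cons b g W)) := by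
  intro hopt
  obtain ⟨L⟩ := exists_oddLeaf f hf
  have hWlt := out_lt_tot hW
  -- moving the tree with root `v` from `a` to the neighbour of the leaf
  have h1 : L.p₀ ≤ L.p₁ + 2 * L.q₁ := by
    rcases L.side with ⟨hq, hu⟩ | ⟨B, B1, B2, B3, B4, B5⟩
    · rw [L.p₀_eq, hu]; omega
    · set X := cons v (cons b g W) nil with hX
      have hXlt : X.out < X.tot := out_lt_tot (by simp [hX])
      have h := hopt a (B X) (by
        simp only [hX, labels_cons, B1, labels_nil, add_zero, Multiset.add_cons]
        rw [Multiset.cons_swap]) (by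
        cases hWE : W.hasE <;> simp [hX, B2, B3, hf, hg, hWE]
        ring)
      have h' : (cons v (cons a f (cons b g W)) nil).tot
          = (L.p₀ + L.p₁) * X.tot + (L.q₀ + L.q₁) * X.out := by
        simp [hX, L.tot_eq, L.out_eq]; ring
      rw [h'] at h
      simp only [tot_cons, B4, B5, tot_nil, mul_one] at h
      have e1 := L.p₀_eq
      have e2 := L.q₀_eq
      by_contra hcon
      push Not at hcon
      obtain ⟨d, hd⟩ := Nat.exists_eq_add_of_lt hcon
      obtain ⟨k, hk⟩ := Nat.exists_eq_add_of_lt hXlt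
      have hu : L.u = 2 * L.q₁ + d + 1 := by omega
      rw [e1, e2, hu, hk] at h
      nlinarith
  -- moving `W` from `v` to the leaf
  have h2 : (L.p₁ + L.q₁) * (g.tot + g.out) ≤ L.p₀ * g.tot := by
    have h := hopt v (cons a (L.graft W) (cons b g nil)) (by
        simp only [labels_cons, L.labels_graft, labels_nil, add_zero, Multiset.add_cons]
        congr 2
        abel_nf) (by
        have h := L.ess_graft W
        have h' := L.hasE_graft W
        cases hWE : W.hasE <;> cases hgr : (L.graft W).hasE <;>
          simp [hf, hg, hWE, hgr] at h h' ⊢ <;> omega)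
    simp only [tot_cons, out_cons, L.tot_graft, L.out_graft, tot_nil, out_nil, mul_one,
      L.tot_eq, L.out_eq] at h
    obtain ⟨k, hk⟩ := Nat.exists_eq_add_of_lt hWlt
    rw [hk] at h
    by_contra hcon
    push Not at hcon
    obtain ⟨d, hd⟩ := Nat.exists_eq_add_of_lt hcon
    nlinarith
  have hc := L.correlation
  have hq := L.q₀_pos
  have hp := L.p₁_pos
  rw [L.tot_eq, L.out_eq] at hle
  -- By `hle` the ratio `g.out / g.tot` in `h2` may be lowered to `f.out / f.tot`, which eliminates
  -- `g`.
  have h3 : (L.p₁ + L.q₁) * (L.p₀ + L.p₁ + L.q₀ + L.q₁) ≤ L.p₀ * (L.p₀ + L.p₁) := by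
    refine Nat.le_of_mul_le_mul_left ?_ g.tot_pos
    have e1 := Nat.mul_le_mul_right (L.p₀ + L.p₁) h2
    have e2 := Nat.mul_le_mul_left (L.p₁ + L.q₁) hle
    nlinarith
  have h4 := Nat.mul_le_mul_right (L.p₀ + L.p₁) h1
  -- Together, `h3`, `h4` and `hc` give `q₁ * (q₀ + q₁) ≤ 0`; if `q₁ = 0`, they give `p₁ * q₀ ≤ 0`
  -- instead.
  rcases Nat.eq_zero_or_pos L.q₁ with h0 | h0
  · rw [h0] at h3 h4
    nlinarith [Nat.mul_pos hp hq]
  · nlinarith [Nat.mul_pos h0 h0]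

/-- In an optimal tree a vertex of degree at least `3` has at most one neighbour that is not
of type `E`. -/
theorem not_opt_of_hasE_of_hasE {v a b : V} {f g W : Forest V} (hW : W ≠ nil)
    (hf : f.hasE = true) (hg : g.hasE = true) : ¬ Opt v (cons a f (cons b g W)) := by
  intro h
  rcases le_total (f.out * g.tot) (g.out * f.tot) with hle | hle
  · exact not_opt_of_le hW hf hg hle h
  · exact not_opt_of_le hW hg hf hle (h.congr (same_move v a f (cons b g nil) W))

/-- Every vertex of type `E` has at most one child. -/
def Slim : Forest V → Prop
  | nil => True
  | cons _ c s => (c.hasE = false → c.len ≤ 1) ∧ Slim c ∧ Slim s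

/-- A vertex of type E with two children has degree at least 3, because of its parent, and its
children are not of type E; reroot there. The forest `s` keeps the branches already treated. -/
theorem slim_of_opt : ∀ (f : Forest V) (r : V) (s : Forest V), Opt r (f.append s) → Slim f
  | nil, _, _, _ => trivial
  | cons v c t, r, s, h => by
    have h' : Opt v (c.append (cons r (t.append s) nil)) := h.congr (same_reroot r v c _)
    refine ⟨fun hc => ?_, slim_of_opt c v _ h', slim_of_opt t r (s.append (cons v c nil)) ?_⟩
    · match c, hc, h' with
      | nil, _, _ => simp
      | cons a f nil, _, _ => simp
      | cons a f (cons b g W), hc, h' =>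
        simp only [hasE_cons, Bool.or_eq_false_iff, Bool.not_eq_eq_eq_not, Bool.not_false] at hc
        refine absurd h' (not_opt_of_hasE_of_hasE ?_ hc.1 hc.2.1)
        cases W <;> simp
    · refine h.congr ((same_append_comm r (cons v c nil) (t.append s)).trans ?_)
      rw [append_assoc]
      exact Same.refl _ _

end Forest

end StableTree

/-! ### Second exchange: neighbours of both kinds, by comparison with a path. -/

namespace StableTree

/-- Two steps of the recursion `x ↦ 1 / (1 + x)` for the occupation ratios along a path. -/
def pathStep (x : ℚ) : ℚ := (1 + x) / (2 + x)

theorem pathStep_nonneg {x : ℚ} (hx : 0 ≤ x) : 0 ≤ pathStep x := by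
  unfold pathStep; positivity

theorem pathStep_mono {x y : ℚ} (hx : 0 ≤ x) (h : x ≤ y) : pathStep x ≤ pathStep y := by
  unfold pathStep
  rw [div_le_div_iff₀ (by linarith) (by linarith)]
  nlinarith

theorem pathStep_iterate_nonneg (k : ℕ) {x : ℚ} (hx : 0 ≤ x) : 0 ≤ pathStep^[k] x := by
  induction k with
  | zero => simpa
  | succ k ih => rw [Function.iterate_succ_apply']; exact pathStep_nonneg ih

theorem pathStep_iterate_mono (k : ℕ) {x y : ℚ} (hx : 0 ≤ x) (h : x ≤ y) :
    pathStep^[k] x ≤ pathStep^[k] y := by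
  induction k with
  | zero => simpa
  | succ k ih =>
    rw [Function.iterate_succ_apply', Function.iterate_succ_apply']
    exact pathStep_mono (pathStep_iterate_nonneg k hx) ih

namespace Forest

variable {V : Type*}

theorem exists_append_of_hasE : ∀ {g : Forest V}, g.hasE = true →
    ∃ t e c s, g = append t (cons e c s) ∧ c.hasE = false
  | nil, h => by simp at h
  | cons e c s, h => by
    cases hc : c.hasE
    · exact ⟨nil, e, c, s, rfl, hc⟩
    · obtain ⟨t, e', c', s', h1, h2⟩ := exists_append_of_hasE (g := s) (by simpa [hc] using h)
      exact ⟨cons e c t, e', c', s', by simp [h1], h2⟩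

theorem slim_append {f g : Forest V} : (f.append g).Slim ↔ f.Slim ∧ g.Slim := by
  induction f with
  | nil => simp [Slim]
  | cons v c s _ ih => simp [Slim, ih, and_assoc]

/-- A leaf `l` at even distance from a vertex `e` with children `c`. The numbers `o₀, o₁` count the
stable sets of `c` (those of the tree that avoid `e`) which avoid, respectively contain `l`, and
`i₀, i₁` count those without roots (those of the tree that contain `e`). `graft X` joins the roots
of `X` to `l`. The last two fields compare the tree with a path of `2 * k + 1` vertices. -/
structure EvenLeaf (c : Forest V) where
  (o₀ o₁ i₀ i₁ k : ℕ)
  graft : Forest V → Forest V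
  labels_graft : ∀ X, (graft X).labels = c.labels + X.labels
  hasE_graft : ∀ X, X.hasE = false → (graft X).hasE = false
  ess_graft : ∀ X, X.hasE = false → (graft X).ess = c.ess + X.ess
  tot_graft : ∀ X, (graft X).tot = o₀ * X.tot + o₁ * X.out
  out_graft : ∀ X, (graft X).out = i₀ * X.tot + i₁ * X.out
  tot_eq : c.tot = o₀ + o₁
  out_eq : c.out = i₀ + i₁
  o₀_pos : 0 < o₀
  root_ratio : pathStep^[k] 1 * (o₀ + o₁) ≤ i₀ + i₁
  leaf_ratio : ∀ h : ℚ, 0 ≤ h →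
    i₀ + o₀ * (1 + h) ≤ (1 + pathStep^[k] h) * (i₁ + o₁ * (1 + h))

/-- The leaf is `e` itself. -/
def EvenLeaf.self : EvenLeaf (nil : Forest V) where
  o₀ := 1
  o₁ := 0
  i₀ := 0
  i₁ := 1
  k := 0
  graft X := X
  labels_graft X := by simp
  hasE_graft X hX := hX
  ess_graft X _ := by simp
  tot_graft X := by simp
  out_graft X := by simp
  tot_eq := by simp
  out_eq := by simp
  o₀_pos := one_pos
  root_ratio := by simp
  leaf_ratio h _ := by simp

/-- Prolonging a tree by a path of two edges above its root. -/
def EvenLeaf.extend (w e : V) {c : Forest V} (t s : Forest V) (L : EvenLeaf c)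
    (hc : c.hasE = false) : EvenLeaf (cons w (t.append (cons e c s)) nil) where
  o₀ := (L.i₀ + L.o₀) * (t.tot * s.tot) + L.o₀ * (t.out * s.out)
  o₁ := (L.i₁ + L.o₁) * (t.tot * s.tot) + L.o₁ * (t.out * s.out)
  i₀ := (L.i₀ + L.o₀) * (t.tot * s.tot)
  i₁ := (L.i₁ + L.o₁) * (t.tot * s.tot)
  k := L.k + 1
  graft X := cons w (t.append (cons e (L.graft X) s)) nil
  labels_graft X := by
    simp only [labels_cons, labels_append, L.labels_graft, labels_nil, Multiset.cons_add,
      Multiset.add_cons, add_zero]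
    congr 2
    abel
  hasE_graft X hX := by simp [L.hasE_graft X hX]
  ess_graft X hX := by simp [L.hasE_graft X hX, L.ess_graft X hX, hc]; ring
  tot_graft X := by simp [L.tot_graft, L.out_graft]; ring
  out_graft X := by simp [L.tot_graft, L.out_graft]; ring
  tot_eq := by simp [L.tot_eq, L.out_eq]; ring
  out_eq := by simp [L.tot_eq, L.out_eq]; ring
  o₀_pos := by
    have := L.o₀_pos; have := t.tot_pos; have := s.tot_pos; positivity
  root_ratio := by
    rw [Function.iterate_succ_apply']
    set x := pathStep^[L.k] 1
    have hx : 0 ≤ x := pathStep_iterate_nonneg _ zero_le_one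
    have h := L.root_ratio
    have hS : ((t.out * s.out : ℕ) : ℚ) ≤ ((t.tot * s.tot : ℕ) : ℚ) := by
      exact_mod_cast Nat.mul_le_mul t.out_le_tot s.out_le_tot
    have hS' : (0 : ℚ) ≤ ((t.out * s.out : ℕ) : ℚ) := Nat.cast_nonneg _
    rw [pathStep, div_mul_eq_mul_div, div_le_iff₀ (by linarith)]
    push_cast at hS hS' ⊢
    set S : ℚ := t.tot * s.tot
    set S' : ℚ := t.out * s.out
    have h1 : (1 + x) * (L.o₀ + L.o₁) * S' ≤ (L.i₀ + L.i₁ + L.o₀ + L.o₁) * S' :=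
      mul_le_mul_of_nonneg_right (by linarith) hS'
    have h2 : ((L.i₀ + L.i₁ + L.o₀ + L.o₁ : ℕ) : ℚ) * S'
        ≤ ((L.i₀ + L.i₁ + L.o₀ + L.o₁ : ℕ) : ℚ) * S :=
      mul_le_mul_of_nonneg_left hS (Nat.cast_nonneg _)
    push_cast at h2
    linarith
  leaf_ratio h hh := by
    rw [Function.iterate_succ_apply]
    have hSS : ((t.out * s.out : ℕ) : ℚ) ≤ ((t.tot * s.tot : ℕ) : ℚ) := by
      exact_mod_cast Nat.mul_le_mul t.out_le_tot s.out_le_tot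
    have hS' : (0 : ℚ) ≤ ((t.out * s.out : ℕ) : ℚ) := Nat.cast_nonneg _
    have hS : (0 : ℚ) < ((t.tot * s.tot : ℕ) : ℚ) := by
      exact_mod_cast Nat.mul_pos t.tot_pos s.tot_pos
    push_cast at hS hSS hS' ⊢
    set S : ℚ := t.tot * s.tot
    set S' : ℚ := t.out * s.out
    have hD : 0 < (2 + h) * S := by positivity
    -- Everything above `e` is condensed into one weight: up to the factor `(2 + h) * S`, sets
    -- containing `e` get weight `1` and sets avoiding it `1 + y`. The siblings of `e` only lower
    -- `y` below its value `pathStep h` on a path.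
    set y := (1 + h) * S' / ((2 + h) * S) with hy
    have hy0 : 0 ≤ y := by positivity
    have hyS : y * ((2 + h) * S) = (1 + h) * S' := by rw [hy]; field_simp
    have hyle : y ≤ pathStep h := by
      rw [hy, pathStep, div_le_div_iff₀ hD (by linarith)]
      have : (1 + h) * (2 + h) * S' ≤ (1 + h) * (2 + h) * S :=
        mul_le_mul_of_nonneg_left hSS (by positivity)
      linarith
    have key := L.leaf_ratio y hy0
    have hmono := pathStep_iterate_mono L.k hy0 hyle
    have hpos : (0 : ℚ) ≤ L.i₁ + L.o₁ * (1 + y) := by positivity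
    have h3 := key.trans (mul_le_mul_of_nonneg_right
      (show 1 + pathStep^[L.k] y ≤ 1 + pathStep^[L.k] (pathStep h) by linarith) hpos)
    have h4 := mul_le_mul_of_nonneg_right h3 hD.le
    set z := pathStep^[L.k] (pathStep h)
    calc _ = ((L.i₀ : ℚ) + L.o₀) * ((2 + h) * S) + L.o₀ * ((1 + h) * S') := by ring
      _ = (L.i₀ + L.o₀ * (1 + y)) * ((2 + h) * S) := by rw [← hyS]; ring
      _ ≤ _ := h4
      _ = (1 + z) * ((L.i₁ + L.o₁) * ((2 + h) * S) + L.o₁ * (y * ((2 + h) * S))) := by ring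
      _ = _ := by rw [hyS]; ring

/-- Slimness leaves a vertex of type E at most one child. That child is not of type E, hence has a
child of type E at which the descent continues. -/
theorem exists_evenLeaf (n : ℕ) : ∀ c : Forest V, c.labels.card ≤ n → c.hasE = false →
    c.len ≤ 1 → c.Slim → Nonempty (EvenLeaf c) := by
  induction n with
  | zero =>
    intro c hn _ _ _
    cases c with
    | nil => exact ⟨EvenLeaf.self⟩
    | cons w g s => simp at hn
  | succ n ih =>
    intro c hn hc hlen hslim
    cases c with
    | nil => exact ⟨EvenLeaf.self⟩
    | cons w g s =>
      cases s with
      | cons v c s => simp at hlen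
      | nil =>
        obtain ⟨t, e, c', s, rfl, hc'⟩ := exists_append_of_hasE (g := g) (by simpa using hc)
        have hs := (slim_append.1 hslim.2.1).2
        obtain ⟨L⟩ := ih c' (by simp at hn; omega) hc' (hs.1 hc') hs.2.1
        exact ⟨L.extend w e t s hc'⟩

/-- With `x = pathStep^[k] 1`, adding the two path comparisons, the second at `h = 1`, gives `(2 +
x) * o₀ ≤ (2 + x) * (i₁ + o₁)`. A path gives equality. -/
theorem EvenLeaf.o₀_le {c : Forest V} (L : EvenLeaf c) : L.o₀ ≤ L.i₁ + L.o₁ := by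
  have h1 := L.root_ratio
  have h2 := L.leaf_ratio 1 zero_le_one
  have hx : 0 ≤ pathStep^[L.k] 1 := pathStep_iterate_nonneg _ zero_le_one
  set x := pathStep^[L.k] 1
  have : (L.o₀ : ℚ) ≤ L.i₁ + L.o₁ := by
    by_contra h
    push Not at h
    nlinarith
  exact_mod_cast this

theorem Opt.slim {v : V} {f : Forest V} (h : Opt v f) : f.Slim :=
  slim_of_opt f v nil (by rwa [append_nil])

/-- In an optimal tree, a vertex with a neighbour of type `E` and one not of type `E` has degree
at most `2`. -/
theorem not_opt_of_hasE_of_not_hasE {v w e : V} {f c W : Forest V} (hW : W ≠ nil)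
    (hf : f.hasE = true) (hc : c.hasE = false) : ¬ Opt v (cons w f (cons e c W)) := by
  intro hopt
  have hslim := hopt.slim.2.2
  obtain ⟨L⟩ := exists_evenLeaf _ c le_rfl hc (hslim.1 hc) hslim.2.1
  set X := cons w f nil with hX
  have hXlt : X.out < X.tot := out_lt_tot (by simp [hX])
  have hXE : X.hasE = false := by simp [hX, hf]
  have h := hopt v (cons e (L.graft X) W) (by
    simp only [hX, labels_cons, L.labels_graft, labels_nil, add_zero, Multiset.add_cons,
      Multiset.cons_add]
    congr 1
    rw [Multiset.cons_swap]
    congr 2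
    abel) (by
    simp only [ess_cons, L.ess_graft X hXE, L.hasE_graft X hXE, hasE_cons]
    simp [hX, hc, hf]; ring)
  have h' : (cons v (cons w f (cons e c W)) nil).tot
      = X.tot * ((L.o₀ + L.o₁ + (L.i₀ + L.i₁)) * W.tot) + X.out * ((L.o₀ + L.o₁) * W.out) := by
    simp [hX, L.tot_eq, L.out_eq]
  rw [h'] at h
  simp only [tot_cons, out_cons, L.tot_graft, L.out_graft, tot_nil, mul_one] at h
  have hWlt := out_lt_tot hW
  have ho := L.o₀_le
  have ho' := L.o₀_pos
  -- With the branch `X` at `w` removed, the left side counts the sets with `v` in and the leaf out,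
  -- the right side those with the leaf in and `v` out. So moving `X` from `v` to the leaf is a
  -- strict gain.
  have key : L.o₀ * W.out < (L.i₁ + L.o₁) * W.tot :=
    (Nat.mul_lt_mul_of_pos_left hWlt ho').trans_le (Nat.mul_le_mul_right _ ho)
  obtain ⟨d, hd⟩ := Nat.exists_eq_add_of_lt key
  obtain ⟨k, hk⟩ := Nat.exists_eq_add_of_lt hXlt
  rw [hk] at h
  nlinarith

end Forest

end StableTree

/-! ### Third exchange: balancing the degrees of the centers. -/

namespace StableTree

theorem one_add_pow_lt_two {k : ℕ} (hk : 2 ≤ k) :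
    (1 + 1 / (2 * (k + 1)) : ℝ) ^ (k + 2) < 2 := by
  rcases hk.eq_or_lt with rfl | hk
  · norm_num
  · have hk' : (3 : ℝ) ≤ k := by exact_mod_cast hk
    have h1 : (1 + 1 / (2 * (k + 1)) : ℝ) ≤ Real.exp (1 / (2 * (k + 1))) := by
      rw [add_comm]; exact Real.add_one_le_exp _
    refine (pow_le_pow_left₀ (by positivity) h1 _).trans_lt ?_
    rw [← Real.exp_nat_mul, ← Real.lt_log_iff_exp_lt two_pos]
    refine lt_of_le_of_lt ?_ Real.log_two_gt_d9
    push_cast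
    rw [mul_one_div, div_le_iff₀ (by positivity)]
    linarith

/-- An upper bound for the factor that a child of type `E` contributes in a tree in which every
vertex not of type `E` has at least `k` children. -/
theorem exists_factor_bound {k : ℕ} (hk : 1 ≤ k) :
    ∃ x : ℝ, 1 / 2 ≤ x ∧ x ≤ 1 ∧ 1 + x ^ k ≤ x * (2 + x ^ k) ∧ x ^ (k + 2) * 2 ^ (k + 1) < 1 := by
  rcases hk.eq_or_lt with rfl | hk
  · exact ⟨5 / 8, by norm_num, by norm_num, by norm_num, by norm_num⟩
  · have hB := one_add_pow_lt_two hk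
    -- For `x = (1 + u) / 2` the two bounds read `(1 + u) ^ k * (1 - u) ≤ 2 ^ (k + 1) * u` and `(1 +
    -- u) ^ (k + 2) < 2`. This `u` is large enough for the first and small enough for the second.
    set u : ℝ := 1 / (2 * (k + 1)) with hu
    have hu0 : 0 < u := by positivity
    have hu1 : u ≤ 1 := by
      rw [hu, div_le_one (by positivity)]
      have : (0 : ℝ) ≤ k := Nat.cast_nonneg k
      linarith
    refine ⟨(1 + u) / 2, by linarith, by linarith, ?_, ?_⟩
    · suffices h : (1 + u) ^ k * (1 - u) ≤ 2 ^ (k + 1) * u by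
        have h2 : (0 : ℝ) < 2 ^ k := by positivity
        rw [div_pow]
        rw [pow_succ] at h
        have h3 : (1 + u) ^ k / 2 ^ k * (1 - u) ≤ 2 * u := by
          rw [div_mul_eq_mul_div, div_le_iff₀ h2]; linarith
        linarith
      rcases Nat.eq_or_lt_of_le hk with rfl | hk
      · norm_num [hu]
      · have h1 : (1 + u) ^ k ≤ 2 :=
          (pow_le_pow_right₀ (by linarith) (by omega)).trans hB.le
        have h2 : (2 : ℝ) ≤ 2 ^ (k + 1) * u := by
          have h3 : k + 1 ≤ 2 ^ (k - 1) := by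
            have : k - 1 + 1 = k := by omega
            obtain ⟨j, rfl⟩ : ∃ j, k = j + 3 := ⟨k - 3, by omega⟩
            clear * -
            induction j with
            | zero => norm_num
            | succ j ih =>
              have : j + 1 + 3 - 1 = (j + 3 - 1) + 1 := by omega
              rw [this, pow_succ]; omega
          have h4 : ((k : ℝ) + 1) ≤ 2 ^ (k - 1) := by exact_mod_cast h3
          have h5 : (2 : ℝ) ^ (k + 1) = 2 ^ (k - 1) * 4 := by
            rw [show k + 1 = k - 1 + 2 by omega, pow_add]; norm_num
          rw [h5, hu, mul_one_div, le_div_iff₀ (by positivity)]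
          linarith
        nlinarith [pow_pos (show (0 : ℝ) < 1 + u by linarith) k]
    · rw [div_pow, pow_succ (2 : ℝ) (k + 1), div_mul_eq_mul_div, div_lt_one (by positivity)]
      have : (0 : ℝ) < 2 ^ (k + 1) := by positivity
      nlinarith

namespace Forest

variable {V : Type*}

/-- All roots are of type `E`. -/
def AllE : Forest V → Prop
  | nil => True
  | cons _ c s => c.hasE = false ∧ AllE s

theorem allE_append {f g : Forest V} : (f.append g).AllE ↔ f.AllE ∧ g.AllE := by
  induction f with
  | nil => simp [AllE]
  | cons v c s _ ih => simp [AllE, ih, and_assoc]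

/-- If the first child were not of type E, the second child would contradict one of the first two
exchanges, whatever its type. Cycling the branches puts each child in front once. -/
theorem allE_of_three_le_len {r : V} : ∀ (f s : Forest V), Opt r (f.append s) →
    3 ≤ (f.append s).len → f.AllE
  | nil, _, _, _ => trivial
  | cons v c t, s, h, hlen => by
    refine ⟨?_, allE_of_three_le_len t (s.append (cons v c nil))
      (h.congr ((same_append_comm r (cons v c nil) (t.append s)).trans
        (r'' := r) ?_)) ?_⟩
    · match ht : t.append s, h, hlen with
      | nil, _, hlen => simp [ht] at hlen
      | cons w d nil, _, hlen => simp [ht] at hlen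
      | cons w d (cons x e W), h, _ =>
        rw [cons_append, ht] at h
        by_contra hc
        rw [Bool.not_eq_false] at hc
        cases hd : d.hasE
        · exact not_opt_of_hasE_of_not_hasE (by simp) hc hd h
        · exact not_opt_of_hasE_of_hasE (by simp) hc hd h
    · rw [append_assoc]; exact Same.refl _ _
    · simp at hlen ⊢; omega

/-- Every root has at most one child, and if it has a child, this child has at least `k` and at
most `K` children, below which the forest is of the same form. -/
inductive Alt (k K : ℕ) : Forest V → Prop
  | empty : Alt k K nil
  | leaf (v : V) {s : Forest V} : Alt k K s → Alt k K (cons v nil s)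
  | step (v w : V) {g s : Forest V} : k ≤ g.len → g.len ≤ K → Alt k K g → Alt k K s →
      Alt k K (cons v (cons w g nil) s)

theorem Alt.mono {k K k' K' : ℕ} {f : Forest V} (h : Alt k K f) (hk : k' ≤ k) (hK : K ≤ K') :
    Alt k' K' f := by
  induction h with
  | empty => exact .empty
  | leaf v _ ih => exact .leaf v ih
  | step v w h1 h2 _ _ ih1 ih2 => exact .step v w (hk.trans h1) (h2.trans hK) ih1 ih2

theorem alt_append {k K : ℕ} {f g : Forest V} : Alt k K (f.append g) ↔ Alt k K f ∧ Alt k K g := by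
  constructor
  · intro h
    generalize hfg : f.append g = x at h
    induction h generalizing f with
    | empty =>
      cases f with
      | nil => exact ⟨.empty, by rw [nil_append] at hfg; rw [hfg]; exact .empty⟩
      | cons v c s => simp at hfg
    | leaf v hs ih =>
      cases f with
      | nil => exact ⟨.empty, by rw [nil_append] at hfg; rw [hfg]; exact .leaf v hs⟩
      | cons v' c s =>
        simp only [cons_append, cons.injEq] at hfg
        obtain ⟨rfl, rfl, h⟩ := hfg
        exact ⟨.leaf _ (ih h).1, (ih h).2⟩
    | step v w h1 h2 hg hs _ ih =>
      cases f with
      | nil => exact ⟨.empty, by rw [nil_append] at hfg; rw [hfg]; exact .step v w h1 h2 hg hs⟩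
      | cons v' c s =>
        simp only [cons_append, cons.injEq] at hfg
        obtain ⟨rfl, rfl, h⟩ := hfg
        exact ⟨.step _ w h1 h2 hg (ih h).1, (ih h).2⟩
  · rintro ⟨hf, hg⟩
    induction hf with
    | empty => exact hg
    | leaf v _ ih => exact .leaf v ih
    | step v w h1 h2 h3 _ _ ih => exact .step v w h1 h2 h3 ih

theorem Alt.hasE {k K : ℕ} (hk : 1 ≤ k) {f : Forest V} (h : Alt k K f) (hf : f ≠ nil) :
    f.hasE = true := by
  induction h with
  | empty => exact absurd rfl hf
  | leaf v _ ih => simp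
  | @step v w g s h1 h2 _ _ ih1 ih2 =>
    have : g ≠ Forest.nil := by rintro rfl; simp at h1; omega
    simp [ih1 this]

theorem len_le_card (f : Forest V) : f.len ≤ f.labels.card := by
  induction f with
  | nil => simp
  | cons v c s _ ih => simp; omega

/-- A root of type E has at most one child, by slimness. Rerooting at this child bounds its degree
by `K + 1` and makes its own children of type E, so the induction continues below it. -/
theorem alt_of_opt (n : ℕ) (K : ℕ) : ∀ (f : Forest V) (r : V) (s : Forest V),
    f.labels.card ≤ n → Opt r (f.append s) →
    (∀ r' f', Same r (f.append s) r' f' → f'.len ≤ K + 1) → f.AllE → Alt 1 K f := by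
  induction n with
  | zero =>
    intro f r s hn _ _ _
    cases f with
    | nil => exact .empty
    | cons v c t => simp at hn
  | succ n ih =>
    intro f r s hn h hK hE
    cases f with
    | nil => exact .empty
    | cons v c t =>
      have hsame : Same r ((cons v c t).append s) r (t.append (s.append (cons v c nil))) := by
        refine (same_append_comm r (cons v c nil) (t.append s)).trans ?_
        rw [append_assoc]
        exact Same.refl _ _
      have ht : Alt 1 K t := ih t r (s.append (cons v c nil)) (by simp at hn; omega)
        (h.congr hsame) (fun r' f' hs => hK r' f' (hsame.trans hs)) hE.2
      have hcE := hE.1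
      have hlen := h.slim.1 hcE
      match c, hcE, hlen with
      | nil, _, _ => exact .leaf v ht
      | cons w g nil, hcE, _ =>
        have hg : g.hasE = true := by simpa using hcE
        have hsame' : Same r ((cons v (cons w g nil) t).append s) w
            (g.append (cons v (cons r (t.append s) nil) nil)) :=
          (same_reroot r v _ _).trans (same_reroot v w g _)
        have hopt := h.congr hsame'
        have hlen := hK _ _ hsame'
        rw [len_append] at hlen
        refine .step v w ?_ (by simpa using hlen) (ih g w _ (by simp at hn; omega) hopt
          (fun r' f' hs => hK r' f' (hsame'.trans hs)) ?_) ht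
        · cases g with
          | nil => simp at hg
          | cons _ _ _ => simp
        -- A single child of `w` is of type E because `w` is not; with two or more, `w` has degree
        -- at least 3 once its parent `v` is counted.
        · match g, hg, hopt with
          | nil, hg, _ => simp at hg
          | cons x d nil, hg, _ => exact ⟨by simpa using hg, trivial⟩
          | cons x d (cons y e W), _, hopt =>
            exact allE_of_three_le_len _ _ hopt (by simp)

/-- Each tree contributes a factor at most `x`: a single vertex gives `1 / 2`, any other tree gives
`(1 + ρ) / (2 + ρ)` with `ρ = g.out / g.tot ≤ x ^ k`, increasing in `ρ`. -/
theorem Alt.out_le {k K : ℕ} {x : ℝ} (hx : 1 / 2 ≤ x) (hx1 : x ≤ 1)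
    (hxk : 1 + x ^ k ≤ x * (2 + x ^ k)) {f : Forest V} (h : Alt k K f) :
    (f.out : ℝ) ≤ x ^ f.len * f.tot := by
  have hx0 : 0 ≤ x := by linarith
  induction h with
  | empty => simp
  | @leaf v s _ ih =>
    simp only [out_cons, tot_nil, one_mul, len_cons, tot_cons, out_nil]
    push_cast
    rw [pow_succ]
    have h1 := mul_nonneg (pow_nonneg hx0 s.len) (Nat.cast_nonneg (α := ℝ) s.tot)
    nlinarith
  | @step v w g s h1 h2 _ _ ih1 ih2 =>
    simp only [out_cons, tot_nil, mul_one, len_cons, tot_cons, out_nil]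
    push_cast
    have h3 : (g.out : ℝ) ≤ x ^ k * g.tot :=
      ih1.trans (mul_le_mul_of_nonneg_right (pow_le_pow_of_le_one hx0 hx1 h1)
        (Nat.cast_nonneg _))
    have h4 : ((g.tot : ℝ) + g.out) ≤ x * (g.tot + g.out + g.tot) := by
      have hxlt : 0 ≤ 1 - x := by linarith
      have := mul_le_mul_of_nonneg_left h3 hxlt
      nlinarith [Nat.cast_nonneg (α := ℝ) g.tot]
    calc ((g.tot : ℝ) + g.out) * s.out
        ≤ (x * (g.tot + g.out + g.tot)) * (x ^ s.len * s.tot) :=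
          mul_le_mul h4 ih2 (Nat.cast_nonneg _) (by positivity)
      _ = _ := by ring

/-- Deleting the roots from a stable set is at most `2 ^ f.len`-to-one. -/
theorem tot_le_two_pow_mul_out (f : Forest V) : f.tot ≤ 2 ^ f.len * f.out := by
  induction f with
  | nil => simp
  | cons v c s _ ih =>
    simp only [tot_cons, len_cons, out_cons]
    calc (c.tot + c.out) * s.tot ≤ (2 * c.tot) * (2 ^ s.len * s.out) :=
          Nat.mul_le_mul (by have := c.out_le_tot; omega) ih
      _ = _ := by ring

/-- A vertex `b` of the forest `f` with `k` children, not of type `E`. The numbers `p₀, p₁` count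
the stable sets of `f` avoiding, respectively containing `b`, and `q₀, q₁` count those without
roots. `graft X` joins the roots of `X` to `b`. -/
structure InnerVertex (k : ℕ) (f : Forest V) where
  (p₀ p₁ q₀ q₁ : ℕ)
  graft : Forest V → Forest V
  labels_graft : ∀ X, (graft X).labels = f.labels + X.labels
  hasE_graft : ∀ X, (graft X).hasE = f.hasE
  ess_graft : ∀ X, (graft X).ess = f.ess + X.ess
  tot_graft : ∀ X, (graft X).tot = p₀ * X.tot + p₁ * X.out
  out_graft : ∀ X, (graft X).out = q₀ * X.tot + q₁ * X.out
  tot_eq : f.tot = p₀ + p₁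
  out_eq : f.out = q₀ + q₁
  -- With its parent, `b` has `k + 1` neighbours. Deleting these from a stable set and inserting `b`
  -- is at most `2 ^ (k + 1)`-to-one.
  p₀_le : p₀ ≤ 2 ^ (k + 1) * p₁
  q₀_le : q₀ ≤ 2 ^ (k + 1) * q₁

/-- The vertex is the child of the first root. -/
def InnerVertex.child (v w : V) (g s : Forest V) (hg : g.hasE = true) :
    InnerVertex g.len (cons v (cons w g nil) s) where
  p₀ := 2 * g.tot * s.tot
  p₁ := g.out * s.tot
  q₀ := g.tot * s.out
  q₁ := g.out * s.out
  graft X := cons v (cons w (X.append g) nil) s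
  labels_graft X := by
    simp only [labels_cons, labels_append, labels_nil, Multiset.cons_add, add_zero]
    congr 2
    abel
  hasE_graft X := by simp [hg]
  ess_graft X := by simp [hg]; ring
  tot_graft X := by simp; ring
  out_graft X := by simp; ring
  tot_eq := by simp; ring
  out_eq := by simp; ring
  p₀_le := by
    have := Nat.mul_le_mul_right (2 * s.tot) g.tot_le_two_pow_mul_out
    rw [pow_succ]; linarith
  q₀_le := by
    have := Nat.mul_le_mul_right s.out g.tot_le_two_pow_mul_out
    rw [pow_succ]; linarith [Nat.zero_le (2 ^ g.len * g.out * s.out)]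

/-- The vertex is not in the first tree. -/
def InnerVertex.tail (v : V) (c : Forest V) {k : ℕ} {s : Forest V} (L : InnerVertex k s) :
    InnerVertex k (cons v c s) where
  p₀ := (c.tot + c.out) * L.p₀
  p₁ := (c.tot + c.out) * L.p₁
  q₀ := c.tot * L.q₀
  q₁ := c.tot * L.q₁
  graft X := cons v c (L.graft X)
  labels_graft X := by simp [L.labels_graft, add_assoc]
  hasE_graft X := by simp [L.hasE_graft]
  ess_graft X := by simp [L.ess_graft]; ring
  tot_graft X := by simp [L.tot_graft]; ring
  out_graft X := by simp [L.out_graft]; ring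
  tot_eq := by simp [L.tot_eq]; ring
  out_eq := by simp [L.out_eq]; ring
  p₀_le := by linarith [Nat.mul_le_mul_left (c.tot + c.out) L.p₀_le]
  q₀_le := by linarith [Nat.mul_le_mul_left c.tot L.q₀_le]

/-- The vertex lies below the child of the first root. -/
def InnerVertex.descend (v w : V) {k : ℕ} {g : Forest V} (s : Forest V) (L : InnerVertex k g) :
    InnerVertex k (cons v (cons w g nil) s) where
  p₀ := (2 * L.p₀ + L.q₀) * s.tot
  p₁ := (2 * L.p₁ + L.q₁) * s.tot
  q₀ := (L.p₀ + L.q₀) * s.out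
  q₁ := (L.p₁ + L.q₁) * s.out
  graft X := cons v (cons w (L.graft X) nil) s
  labels_graft X := by
    simp only [labels_cons, L.labels_graft, labels_nil, Multiset.cons_add, add_zero]
    congr 2
    abel
  hasE_graft X := by simp [L.hasE_graft]
  ess_graft X := by simp [L.ess_graft, L.hasE_graft]; ring
  tot_graft X := by simp [L.tot_graft, L.out_graft]; ring
  out_graft X := by simp [L.tot_graft, L.out_graft]; ring
  tot_eq := by simp [L.tot_eq, L.out_eq]; ring
  out_eq := by simp [L.tot_eq, L.out_eq]; ring
  p₀_le := by
    have := Nat.mul_le_mul_right s.tot (Nat.add_le_add (Nat.mul_le_mul_left 2 L.p₀_le) L.q₀_le)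
    linarith
  q₀_le := by
    have := Nat.mul_le_mul_right s.out (Nat.add_le_add L.p₀_le L.q₀_le)
    linarith

theorem Alt.exists_innerVertex {k K : ℕ} (hk : 1 ≤ k) {f : Forest V} (h : Alt k K f)
    (h' : ¬ Alt (k + 1) K f) : Nonempty (InnerVertex k f) := by
  induction h with
  | empty => exact absurd .empty h'
  | leaf v _ ih =>
    obtain ⟨L⟩ := ih fun hs => h' (.leaf v hs)
    exact ⟨L.tail v _⟩
  | @step v w g s h1 h2 hg hs ih1 ih2 =>
    by_cases hs' : Alt (k + 1) K s
    · by_cases hg' : Alt (k + 1) K g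
      · rcases h1.eq_or_lt with rfl | h1
        · exact ⟨InnerVertex.child v w g s
            (hg.hasE hk (by rintro rfl; simp at hk))⟩
        · exact absurd (.step v w h1 h2 hg' hs') h'
      · obtain ⟨L⟩ := ih1 hg'
        exact ⟨L.descend v w s⟩
    · obtain ⟨L⟩ := ih2 hs'
      exact ⟨L.tail v _⟩

/-- Move the branch at `v` from `a` to an inner vertex `b` with exactly `k` children. Having many
more neighbours, `a` is occupied too rarely for the move to be a loss. -/
theorem not_opt_of_innerVertex {k K : ℕ} (hk : 1 ≤ k) {a v : V} {c s : Forest V}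
    (hc : c.hasE = false) (hs : Alt k K s) (hs' : ¬ Alt (k + 1) K s) (hlen : k + 2 ≤ s.len) :
    ¬ Opt a (cons v c s) := by
  intro hopt
  obtain ⟨L⟩ := hs.exists_innerVertex hk hs'
  have hsE : s.hasE = true := hs.hasE hk (by rintro rfl; simp at hlen)
  set X := cons v c nil with hX
  have hXlt : X.out < X.tot := out_lt_tot (by simp [hX])
  have h := hopt a (L.graft X) (by
    simp only [hX, labels_cons, L.labels_graft, labels_nil, add_zero, Multiset.add_cons]
    congr 2
    abel) (by simp [hX, L.ess_graft, L.hasE_graft, hsE, hc]; ring)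
  have e : (cons a (cons v c s) nil).tot
      = X.tot * (L.p₀ + L.p₁) + X.out * (L.q₀ + L.q₁) := by
    simp [hX, L.tot_eq, L.out_eq]
  rw [e] at h
  simp only [tot_cons, L.tot_graft, L.out_graft, tot_nil, mul_one] at h
  have h1 : L.p₁ ≤ L.q₀ := by
    by_contra hcon
    push Not at hcon
    obtain ⟨d, hd⟩ := Nat.exists_eq_add_of_lt hcon
    obtain ⟨m, hm⟩ := Nat.exists_eq_add_of_lt hXlt
    rw [hm, hd] at h
    nlinarith
  obtain ⟨x, hx, hx1, hxk, hx2⟩ := exists_factor_bound hk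
  -- The `k + 2` branches each cost `a` a factor `x`, while `b` loses at most `2 ^ (k + 1)`; `hx2`
  -- compares the two.
  have h2 : s.out * 2 ^ (k + 1) < s.tot := by
    have hx0 : 0 ≤ x := by linarith
    have h3 : (s.out : ℝ) ≤ x ^ (k + 2) * s.tot :=
      (hs.out_le hx hx1 hxk).trans (mul_le_mul_of_nonneg_right
        (pow_le_pow_of_le_one hx0 hx1 hlen) (Nat.cast_nonneg _))
    have h4 : (0 : ℝ) < s.tot := by exact_mod_cast s.tot_pos
    have h5 : (s.out : ℝ) * 2 ^ (k + 1) < s.tot :=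
      calc (s.out : ℝ) * 2 ^ (k + 1) ≤ x ^ (k + 2) * s.tot * 2 ^ (k + 1) :=
            mul_le_mul_of_nonneg_right h3 (by positivity)
        _ = x ^ (k + 2) * 2 ^ (k + 1) * s.tot := by ring
        _ < 1 * s.tot := mul_lt_mul_of_pos_right hx2 h4
        _ = s.tot := one_mul _
    exact_mod_cast h5
  rw [L.tot_eq, L.out_eq] at h2
  have h3 := L.p₀_le
  have h4 := L.q₀_le
  have h5 := Nat.mul_le_mul_right (2 ^ (k + 1)) h1
  linarith [Nat.zero_le L.q₀]

/-! ### The structure of optimal trees. -/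

theorem exists_same_len_one : ∀ (f : Forest V) (r : V) (s : Forest V), f ≠ nil →
    ∃ x v c, Same r (f.append s) x (cons v c nil)
  | nil, _, _, h => absurd rfl h
  | cons v nil t, r, s, _ => ⟨v, r, t.append s, same_reroot r v nil _⟩
  | cons v (cons w g u) t, r, s, _ => by
    obtain ⟨x, y, c, h⟩ := exists_same_len_one (cons w g u) v (cons r (t.append s) nil) (by simp)
    exact ⟨x, y, c, (same_reroot r v _ _).trans h⟩
  termination_by f => f.labels.card
  decreasing_by simp

theorem Alt.allE {k K : ℕ} (hk : 1 ≤ k) {f : Forest V} (h : Alt k K f) : f.AllE := by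
  induction h with
  | empty => trivial
  | leaf v _ ih => exact ⟨rfl, ih⟩
  | @step v w g s h1 h2 hg hs ih1 ih2 =>
    exact ⟨by simp [hg.hasE hk (by rintro rfl; simp at h1; omega)], ih2⟩

/-- The structure of optimal trees: they can be rooted so that the vertices at odd depth have at
most one child, while the degrees of the vertices at even depth are `j + 1` or `j + 2`. -/
theorem Opt.exists_alt {r : V} {f : Forest V} (h : Opt r f) (hf : f ≠ nil) :
    ∃ a g j, Same r f a g ∧ Alt (max j 1) (j + 1) g ∧
      ((g.len = 1 ∧ j = 0) ∨ g.len = j + 2) := by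
  classical
  have hbound : ∀ a g, Same r f a g → g.len ≤ f.labels.card := by
    intro a g hs
    have h1 := congrArg Multiset.card hs.labels
    have h2 := g.len_le_card
    simp at h1; omega
  -- The root is chosen so that its degree `N` is the largest among all rerootings.
  set P : ℕ → Prop := fun n => ∃ a g, Same r f a g ∧ g.len = n with hP
  obtain ⟨a, g, hs, hlen⟩ : P (Nat.findGreatest P f.labels.card) :=
    Nat.findGreatest_spec (hbound r f (Same.refl r f)) ⟨r, f, Same.refl r f, rfl⟩
  set N := Nat.findGreatest P f.labels.card
  have hmax : ∀ a' g', Same r f a' g' → g'.len ≤ N := fun a' g' hs' =>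
    Nat.le_findGreatest (hbound a' g' hs') ⟨a', g', hs', rfl⟩
  by_cases hN : 3 ≤ N
  · have hopt := h.congr hs
    have hE : g.AllE := allE_of_three_le_len g nil (by rwa [append_nil]) (by simp; omega)
    have halt : Alt 1 (N - 2 + 1) g := alt_of_opt _ _ g a nil le_rfl (by rwa [append_nil])
      (fun a' g' hs' => by
        rw [append_nil] at hs'
        have := hmax a' g' (hs.trans hs')
        omega) hE
    refine ⟨a, g, N - 2, hs, ?_, Or.inr (by omega)⟩
    rw [max_eq_left (by omega)]
    by_contra hcon
    -- At the least such `k`, some center has exactly `k` children, hence degree `k + 1 ≤ N - 2`.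
    have hex : ∃ k, ¬ Alt (k + 1) (N - 2 + 1) g := ⟨N - 3, by
      rwa [show N - 3 + 1 = N - 2 by omega]⟩
    set k := Nat.find hex with hk
    have hk1 : ¬ Alt (k + 1) (N - 2 + 1) g := Nat.find_spec hex
    have hk0 : 1 ≤ k := by
      by_contra h0
      have : k = 0 := by omega
      rw [this] at hk1
      exact hk1 halt
    have hk2 : Alt k (N - 2 + 1) g := by
      have := Nat.find_min hex (m := k - 1) (by omega)
      rw [not_not, show k - 1 + 1 = k by omega] at this
      exact this
    have hkN : k + 3 ≤ N := by
      by_contra hlt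
      exact hcon (hk2.mono (by omega) le_rfl)
    match g, hlen, hs, hk1, hk2 with
    | nil, hlen, _, _, _ => simp at hlen; omega
    | cons v c nil, hlen, _, _, _ => simp at hlen; omega
    | cons v c (cons w d s), hlen, hs, hk1, hk2 =>
      simp only [len_cons] at hlen
      have hall := hk2.allE hk0
      obtain ⟨h1, h2⟩ := (alt_append (f := cons v c nil)).1 hk2
      obtain ⟨h3, h4⟩ := (alt_append (f := cons w d nil)).1 h2
      -- The branch to be moved must leave a deficient center behind: if there is none outside the
      -- first branch, the branch at `w` is moved instead.
      by_cases hw : Alt (k + 1) (N - 2 + 1) (cons w d s)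
      · refine not_opt_of_innerVertex hk0 hall.2.1
          (alt_append.2 ⟨h4, h1⟩) (fun h5 => hk1 ?_) (by simp; omega)
          ((h.congr hs).congr (same_append_comm a (cons v c nil) (cons w d s)))
        exact (alt_append (f := cons v c nil)).2 ⟨(alt_append.1 h5).2, hw⟩
      · exact not_opt_of_innerVertex hk0 hall.1 h2 hw (by simp; omega) (h.congr hs)
  -- All degrees are at most 2. The tree is rooted at an end, or at the neighbour `v` of that end if
  -- `v` is not of type E.
  · obtain ⟨x, v, c, hx⟩ := exists_same_len_one f r nil hf
    rw [append_nil] at hx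
    have key : ∀ a g, Same r f a g → g.AllE → Alt (max 0 1) (0 + 1) g := fun a g hs hE =>
      alt_of_opt _ _ g a nil le_rfl (by rw [append_nil]; exact h.congr hs)
        (fun a' g' hs' => by
          rw [append_nil] at hs'
          have := hmax a' g' (hs.trans hs')
          omega) hE
    cases hc : c.hasE
    · exact ⟨x, _, 0, hx, key _ _ hx ⟨hc, trivial⟩, Or.inl ⟨rfl, rfl⟩⟩
    · have hs' := hx.trans (same_reroot x v c nil)
      have hl := hmax _ _ hs'
      rw [len_append] at hl
      match c, hc, hl with
      | nil, hc, _ => simp at hc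
      | cons y d (cons _ _ _), _, hl => simp at hl; omega
      | cons y d nil, hc, _ =>
        exact ⟨v, _, 0, hs', key _ _ hs' ⟨by simpa using hc, rfl, trivial⟩, Or.inr (by simp)⟩

/-! ### From rooted forests to graphs. -/

theorem eq_or_mem_labels : ∀ {f : Forest V} {p : V} {e : Sym2 V}, e ∈ f.edges p →
    ∀ x ∈ e, x = p ∨ x ∈ f.labels
  | nil, _, _, h => by simp at h
  | cons v c s, p, e, h => by
    intro x hx
    simp only [edges_cons, Multiset.mem_cons, Multiset.mem_add] at h
    simp only [labels_cons, Multiset.mem_cons, Multiset.mem_add]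
    rcases h with rfl | h | h
    · rcases Sym2.mem_iff.1 hx with rfl | rfl <;> simp
    · rcases eq_or_mem_labels h x hx with h' | h' <;> simp [h']
    · rcases eq_or_mem_labels h x hx with h' | h' <;> simp [h']

theorem card_edges (p : V) (f : Forest V) : (f.edges p).card = f.labels.card := by
  induction f generalizing p with
  | nil => simp
  | cons v c s ihc ihs => simp [ihc, ihs]

theorem not_isDiag : ∀ {f : Forest V} {p : V}, (p ::ₘ f.labels).Nodup →
    ∀ e ∈ f.edges p, ¬ e.IsDiag
  | nil, _, _, e, he => by simp at he
  | cons v c s, p, h, e, he => by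
    simp only [labels_cons, Multiset.nodup_cons, Multiset.mem_cons, Multiset.mem_add,
      Multiset.nodup_add, not_or] at h
    simp only [edges_cons, Multiset.mem_cons, Multiset.mem_add] at he
    rcases he with rfl | he | he
    · exact h.1.1
    · exact not_isDiag (Multiset.nodup_cons.2 ⟨h.2.1.1, h.2.2.1⟩) e he
    · exact not_isDiag (Multiset.nodup_cons.2 ⟨h.1.2.2, h.2.2.2.1⟩) e he

theorem reachable_of_mem (G : SimpleGraph V) : ∀ {f : Forest V} {p : V},
    (∀ x y, s(x, y) ∈ f.edges p → G.Adj x y) → ∀ x ∈ f.labels, G.Reachable p x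
  | nil, _, _, _, hx => by simp at hx
  | cons v c s, p, h, x, hx => by
    simp only [edges_cons, Multiset.mem_cons, Multiset.mem_add] at h
    have hv : G.Reachable p v := (h p v (Or.inl rfl)).reachable
    simp only [labels_cons, Multiset.mem_cons, Multiset.mem_add] at hx
    rcases hx with rfl | hx | hx
    · exact hv
    · exact hv.trans (reachable_of_mem G (fun a b hab => h a b (Or.inr (Or.inl hab))) x hx)
    · exact reachable_of_mem G (fun a b hab => h a b (Or.inr (Or.inr hab))) x hx

/-- The forest `f`, its roots being joined to `p`, is embedded in `G` as an induced subgraph. -/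
def Emb (G : SimpleGraph V) : V → Forest V → Prop
  | _, nil => True
  | p, cons v c s => G.Adj p v ∧ v ∉ c.labels ∧ v ∉ s.labels ∧
      (∀ x ∈ c.labels, x ∉ s.labels) ∧ (∀ x ∈ c.labels, ¬ G.Adj p x) ∧
      (∀ x ∈ s.labels, ∀ y ∈ v ::ₘ c.labels, ¬ G.Adj x y) ∧ Emb G v c ∧ Emb G p s

theorem emb_of_adj_iff (G : SimpleGraph V) : ∀ {f : Forest V} {p : V},
    (p ::ₘ f.labels).Nodup →
    (∀ x ∈ f.labels, ∀ y ∈ p ::ₘ f.labels, (G.Adj x y ↔ s(x, y) ∈ f.edges p)) → Emb G p f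
  | nil, _, _, _ => trivial
  | cons v c s, p, hn, h => by
    simp only [labels_cons, Multiset.nodup_cons, Multiset.mem_cons, Multiset.mem_add,
      Multiset.nodup_add, not_or] at hn
    obtain ⟨⟨hpv, hpc, hps⟩, ⟨hvc, hvs⟩, hnc, hns, hcs⟩ := hn
    have hcs' : ∀ x ∈ c.labels, x ∉ s.labels := fun x hx hx' =>
      Multiset.disjoint_left.1 hcs hx hx'
    simp only [labels_cons, edges_cons, Multiset.mem_cons, Multiset.mem_add] at h
    have key : ∀ {f : Forest V} {q x y : V}, s(x, y) ∈ f.edges q →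
        (x = q ∨ x ∈ f.labels) ∧ (y = q ∨ y ∈ f.labels) := fun hq =>
      ⟨eq_or_mem_labels hq _ (Sym2.mem_mk_left _ _), eq_or_mem_labels hq _ (Sym2.mem_mk_right _ _)⟩
    refine ⟨?_, hvc, hvs, hcs', ?_, ?_, ?_, ?_⟩
    · exact ((h v (Or.inl rfl) p (Or.inl rfl)).2 (Or.inl Sym2.eq_swap)).symm
    · intro x hx hadj
      rcases (h x (Or.inr (Or.inl hx)) p (Or.inl rfl)).1 hadj.symm with h1 | h1 | h1
      · rcases Sym2.eq_iff.1 h1 with ⟨rfl, -⟩ | ⟨rfl, -⟩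
        · exact hpc hx
        · exact hvc hx
      · rcases (key h1).2 with h2 | h2
        · exact hpv h2
        · exact hpc h2
      · rcases (key h1).1 with rfl | h2
        · exact hpc hx
        · exact hcs' x hx h2
    · intro x hx y hy hadj
      rw [Multiset.mem_cons] at hy
      have hyp : y ≠ p := by
        rintro rfl
        rcases hy with h1 | h1
        · exact hpv h1
        · exact hpc h1
      rcases (h x (Or.inr (Or.inr hx)) y (by tauto)).1 hadj with h1 | h1 | h1
      · rcases Sym2.eq_iff.1 h1 with ⟨rfl, -⟩ | ⟨-, rfl⟩
        · exact hps hx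
        · exact hyp rfl
      · rcases (key h1).1 with rfl | h2
        · exact hvs hx
        · exact hcs' x h2 hx
      · rcases (key h1).2 with h2 | h2
        · exact hyp h2
        · rcases hy with rfl | hy
          · exact hvs h2
          · exact hcs' y hy h2
    · refine emb_of_adj_iff G (Multiset.nodup_cons.2 ⟨hvc, hnc⟩) fun x hx y hy => ?_
      rw [Multiset.mem_cons] at hy
      rw [h x (by tauto) y (by tauto)]
      refine ⟨?_, fun h1 => Or.inr (Or.inl h1)⟩
      rintro (h1 | h1 | h1)
      · rcases Sym2.eq_iff.1 h1 with ⟨rfl, -⟩ | ⟨rfl, -⟩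
        · exact absurd hx hpc
        · exact absurd hx hvc
      · exact h1
      · rcases (key h1).1 with rfl | h2
        · exact absurd hx hpc
        · exact absurd h2 (hcs' x hx)
    · refine emb_of_adj_iff G (Multiset.nodup_cons.2 ⟨hps, hns⟩) fun x hx y hy => ?_
      rw [Multiset.mem_cons] at hy
      rw [h x (by tauto) y (by tauto)]
      refine ⟨?_, fun h1 => Or.inr (Or.inr h1)⟩
      rintro (h1 | h1 | h1)
      · rcases Sym2.eq_iff.1 h1 with ⟨rfl, -⟩ | ⟨rfl, -⟩
        · exact absurd hx hps
        · exact absurd hx hvs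
      · rcases (key h1).1 with rfl | h2
        · exact absurd hx hvs
        · exact absurd hx (hcs' x h2)
      · exact h1

/-- The number of stable sets contained in `A`. -/
noncomputable def stab (G : SimpleGraph V) (A : Set V) : ℕ :=
  {S : Set V | S ⊆ A ∧ G.IsIndepSet S}.ncard

theorem stab_union [Finite V] {G : SimpleGraph V} {A B : Set V} (hd : Disjoint A B)
    (h : ∀ x ∈ B, ∀ y ∈ A, ¬ G.Adj x y) : stab G (A ∪ B) = stab G A * stab G B := by
  have himage : {S : Set V | S ⊆ A ∪ B ∧ G.IsIndepSet S}
      = (fun S : Set V × Set V => S.1 ∪ S.2) ''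
        ({S : Set V | S ⊆ A ∧ G.IsIndepSet S} ×ˢ {S : Set V | S ⊆ B ∧ G.IsIndepSet S}) := by
    ext S
    constructor
    · rintro ⟨h1, h2⟩
      refine ⟨(S ∩ A, S ∩ B), ⟨⟨Set.inter_subset_right, h2.mono Set.inter_subset_left⟩,
        ⟨Set.inter_subset_right, h2.mono Set.inter_subset_left⟩⟩, ?_⟩
      simp only
      rw [← Set.inter_union_distrib_left, Set.inter_eq_left]
      exact h1
    · rintro ⟨⟨S₁, S₂⟩, ⟨⟨h1, h2⟩, h3, h4⟩, rfl⟩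
      refine ⟨Set.union_subset_union h1 h3, ?_⟩
      rintro x (hx | hx) y (hy | hy) hxy
      · exact h2 hx hy hxy
      · exact fun hadj => h y (h3 hy) x (h1 hx) hadj.symm
      · exact h x (h3 hx) y (h1 hy)
      · exact h4 hx hy hxy
  have hinj : Set.InjOn (fun S : Set V × Set V => S.1 ∪ S.2)
      ({S : Set V | S ⊆ A ∧ G.IsIndepSet S} ×ˢ {S : Set V | S ⊆ B ∧ G.IsIndepSet S}) := by
    rintro ⟨S₁, S₂⟩ ⟨⟨h1, -⟩, h2, -⟩ ⟨S₁', S₂'⟩ ⟨⟨h1', -⟩, h2', -⟩ heq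
    simp only at heq h1 h2 h1' h2'
    have hdA : ∀ x ∈ A, x ∉ B := fun x hx hx' => Set.disjoint_left.1 hd hx hx'
    have hx := fun x => Set.ext_iff.1 heq x
    simp only [Set.mem_union] at hx
    refine Prod.ext (Set.ext fun x => ?_) (Set.ext fun x => ?_)
    · have := hx x; have := @h1 x; have := @h2 x; have := @h1' x; have := @h2' x
      have := hdA x; simp only; tauto
    · have := hx x; have := @h1 x; have := @h2 x; have := @h1' x; have := @h2' x
      have := hdA x; simp only; tauto
  rw [stab, himage, hinj.ncard_image, Set.ncard_prod]
  rfl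

theorem stab_insert [Finite V] {G : SimpleGraph V} {A B : Set V} {v : V} (hv : v ∉ A)
    (hB : ∀ x, x ∈ B ↔ x ∈ A ∧ ¬ G.Adj v x) : stab G (insert v A) = stab G A + stab G B := by
  have hvB : v ∉ B := fun h => hv ((hB v).1 h).1
  have hsplit : {S : Set V | S ⊆ insert v A ∧ G.IsIndepSet S}
      = {S : Set V | S ⊆ A ∧ G.IsIndepSet S} ∪
        (insert v) '' {S : Set V | S ⊆ B ∧ G.IsIndepSet S} := by
    ext S
    constructor
    · rintro ⟨h1, h2⟩
      by_cases hvS : v ∈ S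
      · refine Or.inr ⟨S \ {v}, ⟨?_, h2.mono Set.sdiff_subset⟩, ?_⟩
        · rintro x ⟨hx, hxv⟩
          rw [Set.mem_singleton_iff] at hxv
          exact (hB x).2 ⟨(h1 hx).resolve_left hxv, h2 hvS hx (Ne.symm hxv)⟩
        · rw [Set.insert_sdiff_singleton, Set.insert_eq_of_mem hvS]
      · exact Or.inl ⟨fun x hx => (h1 hx).resolve_left (by rintro rfl; exact hvS hx), h2⟩
    · rintro (⟨h1, h2⟩ | ⟨S, ⟨h1, h2⟩, rfl⟩)
      · exact ⟨h1.trans (Set.subset_insert _ _), h2⟩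
      · refine ⟨Set.insert_subset_insert fun x hx => ((hB x).1 (h1 hx)).1, ?_⟩
        rintro x (rfl | hx) y (rfl | hy) hxy
        · exact absurd rfl hxy
        · exact ((hB y).1 (h1 hy)).2
        · exact fun hadj => ((hB x).1 (h1 hx)).2 hadj.symm
        · exact h2 hx hy hxy
  have hinj : Set.InjOn (insert v) {S : Set V | S ⊆ B ∧ G.IsIndepSet S} := by
    rintro S ⟨h1, -⟩ S' ⟨h1', -⟩ heq
    have h2 : v ∉ S := fun h => hvB (h1 h)
    have h2' : v ∉ S' := fun h => hvB (h1' h)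
    ext x
    have hx := Set.ext_iff.1 heq x
    simp only [Set.mem_insert_iff] at hx
    by_cases hxv : x = v
    · subst hxv; tauto
    · tauto
  rw [stab, hsplit, Set.ncard_union_eq, hinj.ncard_image]
  · rfl
  · rw [Set.disjoint_left]
    rintro S ⟨h1, -⟩ ⟨S', -, rfl⟩
    exact hv (h1 (Set.mem_insert _ _))

/-- The vertices that are not roots. -/
def nonRoots : Forest V → Multiset V
  | nil => 0
  | cons _ c s => labels c + nonRoots s

theorem mem_labels_of_mem_nonRoots : ∀ {f : Forest V} {x : V}, x ∈ f.nonRoots → x ∈ f.labels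
  | nil, _, h => h
  | cons v c s, x, h => by
    rw [nonRoots, Multiset.mem_add] at h
    simp only [labels_cons, Multiset.mem_cons, Multiset.mem_add]
    rcases h with h | h
    · tauto
    · have := mem_labels_of_mem_nonRoots h; tauto

theorem Emb.mem_nonRoots_iff {G : SimpleGraph V} : ∀ {f : Forest V} {p : V}, Emb G p f → ∀ x,
    x ∈ f.nonRoots ↔ x ∈ f.labels ∧ ¬ G.Adj p x
  | nil, _, _, x => by simp [nonRoots]
  | cons v c s, p, ⟨h1, h2, h3, h4, h5, h6, h7, h8⟩, x => by
    have ih := h8.mem_nonRoots_iff x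
    have h5' := h5 x
    simp only [nonRoots, labels_cons, Multiset.mem_cons, Multiset.mem_add]
    rw [ih]
    constructor
    · rintro (h | h)
      · exact ⟨by tauto, h5' h⟩
      · exact ⟨by tauto, h.2⟩
    · rintro ⟨rfl | h | h, h'⟩
      · exact absurd h1 h'
      · tauto
      · tauto

theorem Emb.stab_eq [Finite V] {G : SimpleGraph V} : ∀ {f : Forest V} {p : V}, Emb G p f →
    stab G {x | x ∈ f.labels} = f.tot ∧ stab G {x | x ∈ f.nonRoots} = f.out
  | nil, _, _ => by
    have : stab G (∅ : Set V) = 1 := by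
      have : {S : Set V | S ⊆ ∅ ∧ G.IsIndepSet S} = {∅} := by
        ext S
        simp only [Set.subset_empty_iff, Set.mem_ofPred_eq, Set.mem_singleton_iff]
        exact ⟨fun h => h.1, fun h => ⟨h, by rw [h]; exact Set.pairwise_empty _⟩⟩
      rw [stab, this, Set.ncard_singleton]
    simpa [nonRoots] using this
  | cons v c s, p, ⟨h1, h2, h3, h4, h5, h6, h7, h8⟩ => by
    obtain ⟨ihc1, ihc2⟩ := h7.stab_eq
    obtain ⟨ihs1, ihs2⟩ := h8.stab_eq
    constructor
    · have e1 : {x | x ∈ (cons v c s).labels}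
          = insert v {x | x ∈ c.labels} ∪ {x | x ∈ s.labels} := by
        ext x; simp [or_assoc]
      rw [e1, stab_union, stab_insert (A := {x | x ∈ c.labels}) (B := {x | x ∈ c.nonRoots}) h2 (h7.mem_nonRoots_iff),
        ihc1, ihc2, ihs1, tot_cons]
      · rw [Set.disjoint_left]
        rintro x (rfl | hx) hx'
        · exact h3 hx'
        · exact h4 x hx hx'
      · intro x hx y hy
        exact h6 x hx y (by simpa using hy)
    · have e1 : {x | x ∈ (cons v c s).nonRoots} = {x | x ∈ c.labels} ∪ {x | x ∈ s.nonRoots} := by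
        ext x; simp [nonRoots]
      rw [e1, stab_union, ihc1, ihs2, out_cons]
      · rw [Set.disjoint_left]
        exact fun x hx hx' => h4 x hx (mem_labels_of_mem_nonRoots hx')
      · intro x hx y hy
        exact h6 x (mem_labels_of_mem_nonRoots hx) y (Multiset.mem_cons_of_mem hy)

/-- The second bound drives the induction: a vertex of `S` that is not of type E has a child of type
E, so one unit is saved below it, which pays for the vertex itself. -/
theorem Emb.countP_le {G : SimpleGraph V} {S : Set V} (hS : G.IsIndepSet S)
    [DecidablePred (· ∈ S)] : ∀ {f : Forest V} {p : V}, Emb G p f →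
    f.labels.countP (· ∈ S) ≤ f.ess ∧
      (p ∈ S → f.hasE = true → f.labels.countP (· ∈ S) + 1 ≤ f.ess)
  | nil, _, _ => by simp
  | cons v c s, p, ⟨h1, h2, h3, h4, h5, h6, h7, h8⟩ => by
    obtain ⟨ihc1, ihc2⟩ := h7.countP_le hS
    obtain ⟨ihs1, ihs2⟩ := h8.countP_le hS
    have hpv : p ∈ S → v ∉ S := fun hp hv => hS hp hv h1.ne h1
    have ihc2' : v ∈ S → c.hasE = true → c.labels.countP (· ∈ S) + 1 ≤ c.ess := ihc2
    simp only [labels_cons, Multiset.countP_cons, Multiset.countP_add, ess_cons, hasE_cons]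
    by_cases hv : v ∈ S
    · have hp : p ∉ S := fun hp => hpv hp hv
      cases hc : c.hasE
      · simp [hv, hp]; omega
      · have := ihc2' hv hc
        simp [hv, hp]; omega
    · cases hc : c.hasE
      · simp [hv]; omega
      · simp only [hv, if_false, cond_true, Bool.not_true, Bool.false_or]
        refine ⟨by omega, fun hp hs => ?_⟩
        have := ihs2 hp hs
        omega

/-- The vertices of type `E`. -/
def essSet : Forest V → Multiset V
  | nil => 0
  | cons v c s => (bif hasE c then 0 else {v}) + (essSet c + essSet s)

theorem card_essSet (f : Forest V) : f.essSet.card = f.ess := by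
  induction f with
  | nil => rfl
  | cons v c s ihc ihs => cases hc : c.hasE <;> simp [essSet, ihc, ihs, hc, add_comm]

theorem essSet_le (f : Forest V) : f.essSet ≤ f.labels := by
  induction f with
  | nil => exact le_rfl
  | cons v c s ihc ihs =>
    rw [essSet, labels_cons, ← Multiset.singleton_add]
    refine add_le_add ?_ (add_le_add ihc ihs)
    cases c.hasE <;> simp

theorem Emb.not_adj_of_mem_essSet {G : SimpleGraph V} : ∀ {f : Forest V} {p : V}, Emb G p f →
    (f.hasE = false → ∀ x ∈ f.essSet, ¬ G.Adj p x) ∧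
      ∀ x ∈ f.essSet, ∀ y ∈ f.essSet, ¬ G.Adj x y
  | nil, _, _ => by simp [essSet]
  | cons v c s, p, ⟨h1, h2, h3, h4, h5, h6, h7, h8⟩ => by
    obtain ⟨ihc1, ihc2⟩ := h7.not_adj_of_mem_essSet
    obtain ⟨ihs1, ihs2⟩ := h8.not_adj_of_mem_essSet
    have hmem : ∀ x, x ∈ (cons v c s).essSet ↔
        (x = v ∧ c.hasE = false) ∨ x ∈ c.essSet ∨ x ∈ s.essSet := by
      intro x
      cases hc : c.hasE <;> simp [essSet, hc]
    have hc : ∀ x ∈ c.essSet, x ∈ c.labels := fun x hx => Multiset.mem_of_le c.essSet_le hx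
    have hs : ∀ x ∈ s.essSet, x ∈ s.labels := fun x hx => Multiset.mem_of_le s.essSet_le hx
    have h6' : ∀ x ∈ s.labels, ∀ y ∈ c.labels, ¬ G.Adj x y := fun x hx y hy =>
      h6 x hx y (Multiset.mem_cons_of_mem hy)
    have h6'' : ∀ x ∈ s.labels, ¬ G.Adj x v := fun x hx => h6 x hx v (Multiset.mem_cons_self _ _)
    constructor
    · intro hE x hx
      simp only [hasE_cons, Bool.or_eq_false_iff, Bool.not_eq_eq_eq_not, Bool.not_false] at hE
      rcases (hmem x).1 hx with ⟨-, h⟩ | h | h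
      · rw [hE.1] at h; cases h
      · exact h5 x (hc x h)
      · exact ihs1 hE.2 x h
    · intro x hx y hy hadj
      replace hx := (hmem x).1 hx
      replace hy := (hmem y).1 hy
      rcases hx with ⟨rfl, hx⟩ | hx | hx <;> rcases hy with ⟨rfl, hy⟩ | hy | hy
      · exact hadj.ne rfl
      · exact ihc1 hx y hy hadj
      · exact h6'' y (hs y hy) hadj.symm
      · exact ihc1 hy x hx hadj.symm
      · exact ihc2 x hx y hy hadj
      · exact h6' y (hs y hy) x (hc x hx) hadj.symm
      · exact h6'' x (hs x hx) hadj
      · exact h6' x (hs x hx) y (hc y hy) hadj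
      · exact ihs2 x hx y hy hadj

end Forest

open Forest

variable {V : Type*}

/-- The graph `T` is the tree with root `r` and children `f`. -/
structure Represents (T : SimpleGraph V) (r : V) (f : Forest V) : Prop where
  nodup : (r ::ₘ f.labels).Nodup
  mem : ∀ x, x ∈ r ::ₘ f.labels
  adj : ∀ x y, T.Adj x y ↔ s(x, y) ∈ f.edges r

namespace Represents

variable {T : SimpleGraph V} {r : V} {f : Forest V}

theorem emb (h : Represents T r f) : Emb T r f :=
  emb_of_adj_iff T h.nodup fun x _ y _ => h.adj x y

theorem congr (h : Represents T r f) {a : V} {g : Forest V} (hs : Same r f a g) :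
    Represents T a g := by
  have hl := hs.labels
  simp only [labels_cons, labels_nil, add_zero] at hl
  refine ⟨hl ▸ h.nodup, fun x => hl ▸ h.mem x, fun x y => ?_⟩
  rw [← hs.edges]
  exact h.adj x y

theorem card_eq (h : Represents T r f) : Nat.card V = f.labels.card + 1 := by
  let : Fintype V := ⟨⟨_, h.nodup⟩, h.mem⟩
  have : Finset.univ.val (α := V) = r ::ₘ f.labels := rfl
  rw [Nat.card_eq_fintype_card, Fintype.card, Finset.card, this, Multiset.card_cons]

theorem connected (h : Represents T r f) : T.Connected := by
  have hr : ∀ x, T.Reachable r x := by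
    intro x
    rcases Multiset.mem_cons.1 (h.mem x) with rfl | hx
    · exact SimpleGraph.Reachable.refl _
    · exact reachable_of_mem T (fun a b hab => (h.adj a b).2 hab) x hx
  have : Nonempty V := ⟨r⟩
  exact ⟨fun x y => (hr x).symm.trans (hr y)⟩

theorem edgeSet_eq (h : Represents T r f) : T.edgeSet = {e | e ∈ f.edges r} := by
  ext e
  induction e with
  | h x y => rw [SimpleGraph.mem_edgeSet, h.adj]; rfl

theorem finite (h : Represents T r f) : Finite V :=
  ⟨(⟨⟨_, h.nodup⟩, h.mem⟩ : Fintype V).equivFin⟩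

theorem isTree (h : Represents T r f) : T.IsTree := by
  classical
  have := h.finite
  refine SimpleGraph.isTree_iff_connected_and_card.2 ⟨h.connected, le_antisymm ?_
    h.connected.card_vert_le_card_edgeSet_add_one⟩
  have e : {e | e ∈ f.edges r} = ((f.edges r).toFinset : Set (Sym2 V)) := by ext; simp
  rw [Nat.card_coe_set_eq, h.edgeSet_eq, e, Set.ncard_coe_finset, h.card_eq, ← card_edges r f]
  exact Nat.succ_le_succ (Multiset.toFinset_card_le _)

/-- A tree on `n` vertices has `n - 1` edges, which is also the length of the edge list; a
repetition would leave too few. -/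
theorem edges_nodup (h : Represents T r f) : (f.edges r).Nodup := by
  classical
  have := h.finite
  have h1 := (SimpleGraph.isTree_iff_connected_and_card.1 h.isTree).2
  have e : {e | e ∈ f.edges r} = ((f.edges r).toFinset : Set (Sym2 V)) := by ext; simp
  rw [Nat.card_coe_set_eq, h.edgeSet_eq, e, Set.ncard_coe_finset, h.card_eq,
    ← card_edges r f] at h1
  rw [← Multiset.dedup_card_eq_card_iff_nodup]
  have h2 : (f.edges r).toFinset.card = (f.edges r).dedup.card := rfl
  omega

theorem fibNumber_eq (h : Represents T r f) : fibNumber T = (cons r f nil).tot := by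
  have := h.finite
  have hr : r ∉ f.labels := (Multiset.nodup_cons.1 h.nodup).1
  have huniv : insert r {x | x ∈ f.labels} = Set.univ :=
    Set.eq_univ_of_forall fun x => by simpa using h.mem x
  have h1 : fibNumber T = stab T (insert r {x | x ∈ f.labels}) := by
    rw [huniv, stab, fibNumber]; simp
  rw [h1, stab_insert (A := {x | x ∈ f.labels}) (B := {x | x ∈ f.nonRoots}) hr
    h.emb.mem_nonRoots_iff, h.emb.stab_eq.1, h.emb.stab_eq.2]
  simp

theorem indepNum_eq (h : Represents T r f) : T.indepNum = (cons r f nil).ess := by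
  classical
  have := h.finite
  let : Fintype V := ⟨⟨_, h.nodup⟩, h.mem⟩
  have hr : r ∉ f.labels := (Multiset.nodup_cons.1 h.nodup).1
  apply le_antisymm
  · obtain ⟨S, hS⟩ := T.exists_isNIndepSet_indepNum
    have h1 := h.emb.countP_le (S := (S : Set V)) hS.isIndepSet
    have h2 : S.card = (r ::ₘ f.labels).countP (· ∈ (S : Set V)) := by
      have : S = Finset.univ.filter (· ∈ (S : Set V)) := by ext; simp
      conv_lhs => rw [this]
      rw [Multiset.countP_eq_card_filter]
      rfl
    rw [← hS.card_eq, h2, Multiset.countP_cons]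
    by_cases hrS : r ∈ (S : Set V)
    · rw [if_pos hrS]
      cases hE : f.hasE
      · simp only [ess_cons, hE, ess_nil, cond_false]; omega
      · have := h1.2 hrS hE
        simp only [ess_cons, hE, ess_nil, cond_true]; omega
    · rw [if_neg hrS]
      simp only [ess_cons, ess_nil]; omega
  · have hle := (cons r f nil).essSet_le
    have hnd : (cons r f nil).essSet.Nodup := Multiset.nodup_of_le hle (by
      simpa using h.nodup)
    have h1 := h.emb.not_adj_of_mem_essSet
    have hI : T.IsIndepSet ((⟨_, hnd⟩ : Finset V) : Set V) := by
      intro x hx y hy _ hadj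
      have hmem : ∀ x, x ∈ (cons r f nil).essSet → (x = r ∧ f.hasE = false) ∨ x ∈ f.essSet := by
        intro x hx
        cases hE : f.hasE <;> simpa [essSet, hE] using hx
      replace hx := hmem x hx
      replace hy := hmem y hy
      rcases hx with ⟨rfl, hx⟩ | hx <;> rcases hy with ⟨rfl, hy⟩ | hy
      · exact hadj.ne rfl
      · exact h1.1 hx y hy hadj
      · exact h1.1 hy x hx hadj.symm
      · exact h1.2 x hx y hy hadj
    rw [← card_essSet]
    exact hI.card_le_indepNum

end Represents

theorem exists_represents_of_nodup {r : V} {f : Forest V} (hn : (r ::ₘ f.labels).Nodup)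
    (hm : ∀ x, x ∈ r ::ₘ f.labels) : ∃ T : SimpleGraph V, Represents T r f := by
  refine ⟨SimpleGraph.fromEdgeSet {e | e ∈ f.edges r}, hn, hm, fun x y => ?_⟩
  rw [SimpleGraph.fromEdgeSet_adj]
  refine ⟨fun h => h.1, fun h => ⟨h, fun hxy => not_isDiag hn _ h hxy⟩⟩

theorem exists_attach (u x : V) : ∀ (f : Forest V) (p : V), u ∈ p ::ₘ f.labels →
    ∃ f' : Forest V, f'.labels = x ::ₘ f.labels ∧ f'.edges p = s(u, x) ::ₘ f.edges p := by
  intro f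
  induction f with
  | nil =>
    intro p hu
    have : u = p := by simpa using hu
    subst this
    exact ⟨cons x nil nil, by simp, by simp⟩
  | cons v c s ihc ihs =>
    intro p hu
    simp only [labels_cons, Multiset.mem_cons, Multiset.mem_add] at hu
    by_cases hs : u ∈ p ::ₘ s.labels
    · obtain ⟨s', h1, h2⟩ := ihs p hs
      refine ⟨cons v c s', ?_, ?_⟩
      · simp only [labels_cons, h1, Multiset.add_cons]
        rw [Multiset.cons_swap]
      · simp only [edges_cons, h2, Multiset.add_cons]
        rw [Multiset.cons_swap]
    · obtain ⟨c', h1, h2⟩ := ihc v (by rw [Multiset.mem_cons] at hs ⊢; tauto)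
      refine ⟨cons v c' s, ?_, ?_⟩
      · simp only [labels_cons, h1, Multiset.cons_add]
        rw [Multiset.cons_swap]
      · simp only [edges_cons, h2, Multiset.cons_add]
        rw [Multiset.cons_swap]

/-- Every tree can be rooted at every vertex. -/
theorem exists_represents [Finite V] {T : SimpleGraph V} (hT : T.IsTree) (r : V) :
    ∃ f, Represents T r f := by
  classical
  have grow : ∀ n < Nat.card V, ∃ f : Forest V, (r ::ₘ f.labels).Nodup ∧ f.labels.card = n ∧
      ∀ x y, s(x, y) ∈ f.edges r → T.Adj x y := by
    intro n
    induction n with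
    | zero => exact fun _ => ⟨nil, by simp, by simp, by simp⟩
    | succ n ih =>
      intro hn
      obtain ⟨f, h1, h2, h3⟩ := ih (by omega)
      obtain ⟨z, hz⟩ : ∃ z, z ∉ r ::ₘ f.labels := by
        by_contra hcon
        push Not at hcon
        let : Fintype V := ⟨⟨_, h1⟩, hcon⟩
        have : Fintype.card V = (r ::ₘ f.labels).card := rfl
        rw [Nat.card_eq_fintype_card, this, Multiset.card_cons] at hn
        omega
      -- A walk to an uncovered vertex leaves the covered set along an edge, which is then attached.
      obtain ⟨w⟩ := hT.connected.preconnected r z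
      obtain ⟨d, -, hd1, hd2⟩ := w.exists_boundary_dart {x | x ∈ r ::ₘ f.labels}
        (Multiset.mem_cons_self _ _) hz
      obtain ⟨f', h4, h5⟩ := exists_attach d.fst d.snd f r hd1
      refine ⟨f', ?_, by rw [h4, Multiset.card_cons, h2], fun x y hxy => ?_⟩
      · rw [h4, Multiset.cons_swap, Multiset.nodup_cons]
        exact ⟨hd2, h1⟩
      · rw [h5, Multiset.mem_cons] at hxy
        rcases hxy with hxy | hxy
        · rw [← SimpleGraph.mem_edgeSet, hxy]
          exact d.adj
        · exact h3 x y hxy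
  have hpos : 0 < Nat.card V := Nat.card_pos_iff.2 ⟨⟨r⟩, inferInstance⟩
  obtain ⟨f, h1, h2, h3⟩ := grow (Nat.card V - 1) (by omega)
  have hm : ∀ x, x ∈ r ::ₘ f.labels := by
    by_contra hcon
    push Not at hcon
    obtain ⟨z, hz⟩ := hcon
    have h4 : (z ::ₘ r ::ₘ f.labels).Nodup := Multiset.nodup_cons.2 ⟨hz, h1⟩
    let := Fintype.ofFinite V
    have h5 := Finset.card_le_univ (⟨_, h4⟩ : Finset V)
    rw [Finset.card_mk, Multiset.card_cons, Multiset.card_cons, h2,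
      ← Nat.card_eq_fintype_card] at h5
    omega
  -- The forest spans a connected subgraph of `T`, and a tree is a minimal connected graph.
  obtain ⟨G, hG⟩ := exists_represents_of_nodup h1 hm
  have hle : G ≤ T := fun x y hxy => h3 x y ((hG.adj x y).1 hxy)
  have : G = T := (SimpleGraph.isTree_iff_minimal_connected.1 hT).eq_of_le hG.connected hle
  exact ⟨f, this ▸ hG⟩

theorem IsExtremalTree.opt {T : SimpleGraph V} (hT : IsExtremalTree T) {r : V} {f : Forest V}
    (h : Represents T r f) : Opt r f := by
  intro r' f' hl he
  simp only [labels_cons, labels_nil, add_zero] at hl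
  obtain ⟨T', hT'⟩ := exists_represents_of_nodup (r := r') (f := f') (hl ▸ h.nodup)
    (fun x => hl ▸ h.mem x)
  rw [← h.fibNumber_eq, ← hT'.fibNumber_eq]
  exact hT.2 T' hT'.isTree (by rw [h.indepNum_eq, hT'.indepNum_eq, he])

end StableTree

/-! ### Depth classes, degrees, trees of stars and odd paths. -/

namespace StableTree

namespace Forest

variable {V : Type*}

/-- The vertices at even depth, respectively odd depth, the roots having depth `0`. -/
def levels : Forest V → Multiset V × Multiset V
  | nil => (0, 0)
  | cons v c s => (v ::ₘ ((levels c).2 + (levels s).1), (levels c).1 + (levels s).2)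

/-- The vertices at even depth. -/
def evenDepth (f : Forest V) : Multiset V := f.levels.1

/-- The vertices at odd depth. -/
def oddDepth (f : Forest V) : Multiset V := f.levels.2

@[simp] theorem evenDepth_nil : (nil : Forest V).evenDepth = 0 := rfl
@[simp] theorem oddDepth_nil : (nil : Forest V).oddDepth = 0 := rfl
@[simp] theorem evenDepth_cons (v : V) (c s : Forest V) :
    (cons v c s).evenDepth = v ::ₘ (c.oddDepth + s.evenDepth) := rfl
@[simp] theorem oddDepth_cons (v : V) (c s : Forest V) :
    (cons v c s).oddDepth = c.evenDepth + s.oddDepth := rfl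

theorem evenDepth_add_oddDepth (f : Forest V) : f.evenDepth + f.oddDepth = f.labels := by
  induction f with
  | nil => rfl
  | cons v c s ihc ihs =>
    rw [labels_cons, ← ihc, ← ihs, evenDepth_cons, oddDepth_cons, Multiset.cons_add]
    congr 1
    abel

theorem mem_labels_iff {f : Forest V} {x : V} :
    x ∈ f.labels ↔ x ∈ f.evenDepth ∨ x ∈ f.oddDepth := by
  rw [← evenDepth_add_oddDepth, Multiset.mem_add]

theorem mem_levels_of_mem_edges : ∀ {f : Forest V} {p x y : V}, s(x, y) ∈ f.edges p →
    (x ∈ f.evenDepth ∧ y ∈ p ::ₘ f.oddDepth) ∨ (y ∈ f.evenDepth ∧ x ∈ p ::ₘ f.oddDepth)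
  | nil, _, _, _, h => by simp at h
  | cons v c s, p, x, y, h => by
    simp only [edges_cons, Multiset.mem_cons, Multiset.mem_add] at h
    simp only [evenDepth_cons, oddDepth_cons, Multiset.mem_cons, Multiset.mem_add]
    rcases h with h | h | h
    · rcases Sym2.eq_iff.1 h with ⟨rfl, rfl⟩ | ⟨rfl, rfl⟩ <;> simp
    · have := mem_levels_of_mem_edges h
      rw [Multiset.mem_cons, Multiset.mem_cons] at this
      tauto
    · have := mem_levels_of_mem_edges h
      rw [Multiset.mem_cons, Multiset.mem_cons] at this
      tauto

/-- In an alternating forest the types follow the parity of the depth, the roots being of type E. -/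
theorem Alt.card_evenDepth {k K : ℕ} (hk : 1 ≤ k) {f : Forest V} (h : Alt k K f) :
    f.evenDepth.card = f.ess := by
  induction h with
  | empty => rfl
  | leaf v _ ih => simp [ih]
  | @step v w g s h1 _ hg _ ih1 ih2 =>
    have : g.hasE = true := hg.hasE hk (by rintro rfl; simp at h1; omega)
    simp [ih1, ih2, this]

section Degrees

variable [DecidableEq V]

theorem countP_edges_eq_zero {f : Forest V} {p x : V} (hx : x ∉ f.labels) (hxp : x ≠ p) :
    (f.edges p).countP (x ∈ ·) = 0 := by
  rw [Multiset.countP_eq_zero]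
  intro e he hxe
  rcases eq_or_mem_labels he x hxe with h | h
  · exact hxp h
  · exact hx h

theorem countP_edges_root : ∀ {f : Forest V} {p : V}, p ∉ f.labels →
    (f.edges p).countP (p ∈ ·) = f.len
  | nil, _, _ => rfl
  | cons v c s, p, h => by
    simp only [labels_cons, Multiset.mem_cons, Multiset.mem_add, not_or] at h
    rw [edges_cons, Multiset.countP_cons, Multiset.countP_add, countP_edges_eq_zero h.2.1 h.1,
      countP_edges_root h.2.2]
    simp

theorem Alt.countP_edges {k K : ℕ} {f : Forest V} (h : Alt k K f) :
    ∀ {p : V}, (p ::ₘ f.labels).Nodup →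
      (∀ x ∈ f.evenDepth, (f.edges p).countP (x ∈ ·) ≤ 2) ∧
      (∀ x ∈ f.oddDepth, k + 1 ≤ (f.edges p).countP (x ∈ ·) ∧
        (f.edges p).countP (x ∈ ·) ≤ K + 1) := by
  induction h with
  | empty => simp
  | @leaf v s _ ih =>
    intro p hn
    simp only [labels_cons, labels_nil, zero_add, Multiset.nodup_cons, Multiset.mem_cons,
      not_or] at hn
    obtain ⟨ih1, ih2⟩ := ih (p := p) (Multiset.nodup_cons.2 ⟨hn.1.2, hn.2.2⟩)
    have hne : ∀ x ∈ s.labels, x ≠ p ∧ x ≠ v := fun x hx =>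
      ⟨by rintro rfl; exact hn.1.2 hx, by rintro rfl; exact hn.2.1 hx⟩
    simp only [edges_cons, edges_nil, zero_add, Multiset.countP_cons, evenDepth_cons,
      oddDepth_nil, Multiset.mem_cons, oddDepth_cons, evenDepth_nil]
    refine ⟨?_, fun x hx => ?_⟩
    · rintro x (rfl | hx)
      · rw [countP_edges_eq_zero hn.2.1 (Ne.symm hn.1.1)]; simp
      · have := hne x (mem_labels_iff.2 (Or.inl hx))
        simpa [this] using ih1 x hx
    · have := hne x (mem_labels_iff.2 (Or.inr hx))
      simpa [this] using ih2 x hx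
  | @step v w g s h1 h2 _ _ ihg ihs =>
    intro p hn
    simp only [labels_cons, labels_nil, add_zero, Multiset.nodup_cons, Multiset.mem_cons,
      Multiset.mem_add, Multiset.cons_add, Multiset.nodup_add, not_or] at hn
    obtain ⟨⟨hpv, hpw, hpg, hps⟩, ⟨hvw, hvg, hvs⟩, ⟨hwg, hws⟩, hng, hns, hd⟩ := hn
    obtain ⟨ig1, ig2⟩ := ihg (p := w) (Multiset.nodup_cons.2 ⟨hwg, hng⟩)
    obtain ⟨is1, is2⟩ := ihs (p := p) (Multiset.nodup_cons.2 ⟨hps, hns⟩)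
    have hs : ∀ x ∈ s.labels, x ≠ p ∧ x ≠ v ∧ x ≠ w ∧ (g.edges w).countP (x ∈ ·) = 0 := by
      intro x hx
      have hw : x ≠ w := by rintro rfl; exact hws hx
      exact ⟨by rintro rfl; exact hps hx, by rintro rfl; exact hvs hx, hw,
        countP_edges_eq_zero (fun h => Multiset.disjoint_left.1 hd h hx) hw⟩
    have hg : ∀ x ∈ g.labels, x ≠ p ∧ x ≠ v ∧ x ≠ w ∧ (s.edges p).countP (x ∈ ·) = 0 := by
      intro x hx
      have hp : x ≠ p := by rintro rfl; exact hpg hx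
      exact ⟨hp, by rintro rfl; exact hvg hx, by rintro rfl; exact hwg hx,
        countP_edges_eq_zero (fun h => Multiset.disjoint_left.1 hd hx h) hp⟩
    simp only [edges_cons, edges_nil, add_zero, Multiset.cons_add, Multiset.countP_cons,
      Multiset.countP_add, evenDepth_cons, oddDepth_nil, Multiset.mem_cons, oddDepth_cons,
      evenDepth_nil, Multiset.mem_add, Sym2.mem_iff]
    constructor
    · rintro x (rfl | hx | hx)
      · rw [countP_edges_eq_zero hvg hvw, countP_edges_eq_zero hvs (Ne.symm hpv)]; simp
      · have := hg x (mem_labels_iff.2 (Or.inl hx))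
        simpa [this] using ig1 x hx
      · have := hs x (mem_labels_iff.2 (Or.inl hx))
        simpa [this] using is1 x hx
    · rintro x (rfl | hx | hx)
      · rw [countP_edges_eq_zero hws (Ne.symm hpw), countP_edges_root hwg]
        simp [Ne.symm hpw, Ne.symm hvw, h1, h2]
      · have := hg x (mem_labels_iff.2 (Or.inr hx))
        simpa [this] using ig2 x hx
      · have := hs x (mem_labels_iff.2 (Or.inr hx))
        simpa [this] using is2 x hx

end Degrees

/-- The vertex sets and the roots of the trees of a forest. -/
def parts : Forest V → List (Set V × V)
  | nil => []
  | cons v c s => ({x | x ∈ v ::ₘ c.labels}, v) :: parts s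

theorem length_parts (f : Forest V) : f.parts.length = f.len := by
  induction f with
  | nil => rfl
  | cons v c s _ ih => simp [parts, ih]

theorem mem_parts_iff {f : Forest V} {x : V} : (∃ P ∈ f.parts, x ∈ P.1) ↔ x ∈ f.labels := by
  induction f with
  | nil => simp [parts]
  | cons v c s _ ih => simp [parts, ih, or_assoc]

theorem Emb.pairwise_parts {G : SimpleGraph V} : ∀ {f : Forest V} {p : V}, Emb G p f →
    f.parts.Pairwise fun P Q => ∀ x ∈ P.1, ∀ y ∈ Q.1, x ≠ y ∧ ¬ G.Adj x y
  | nil, _, _ => List.Pairwise.nil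
  | cons v c s, p, ⟨h1, h2, h3, h4, h5, h6, h7, h8⟩ => by
    refine List.Pairwise.cons ?_ h8.pairwise_parts
    intro Q hQ x hx y hy
    have hy' : y ∈ s.labels := mem_parts_iff.1 ⟨Q, hQ, hy⟩
    refine ⟨?_, fun hadj => h6 y hy' x hx hadj.symm⟩
    rintro rfl
    rcases Multiset.mem_cons.1 hx with rfl | hx
    · exact h3 hy'
    · exact h4 x hx hy'

theorem Emb.adj_iff_of_mem_parts {G : SimpleGraph V} : ∀ {f : Forest V} {p : V}, Emb G p f →
    ∀ P ∈ f.parts, ∀ x ∈ P.1, G.Adj p x ↔ x = P.2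
  | nil, _, _ => by simp [parts]
  | cons v c s, p, ⟨h1, h2, h3, h4, h5, h6, h7, h8⟩ => by
    rw [parts, List.forall_mem_cons]
    refine ⟨fun x hx => ?_, h8.adj_iff_of_mem_parts⟩
    rcases Multiset.mem_cons.1 hx with rfl | hxc
    · exact ⟨fun _ => rfl, fun _ => h1⟩
    · exact ⟨fun hadj => absurd hadj (h5 x hxc), fun h => absurd hxc (by rwa [show x = v from h])⟩

end Forest

variable {V : Type*}

theorem isTreeOfStarsOn_join {G : SimpleGraph V} {w : V} {L : List (Set V × V)}
    (hL : 2 ≤ L.length)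
    (h : ∀ P ∈ L, IsTreeOfStarsOn G P.1 ∧ IsLeafOn G P.1 P.2 ∧ w ∉ P.1 ∧
      ∀ x ∈ P.1, G.Adj w x ↔ x = P.2)
    (hpw : L.Pairwise fun P Q => ∀ x ∈ P.1, ∀ y ∈ Q.1, x ≠ y ∧ ¬ G.Adj x y) :
    IsTreeOfStarsOn G (insert w {x | ∃ P ∈ L, x ∈ P.1}) := by
  have hne : ∀ i j : Fin L.length, i ≠ j →
      ∀ x ∈ (L.get i).1, ∀ y ∈ (L.get j).1, x ≠ y ∧ ¬ G.Adj x y := by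
    intro i j hij x hx y hy
    rw [List.pairwise_iff_getElem] at hpw
    rcases lt_or_gt_of_ne hij with hlt | hlt
    · exact hpw i j i.2 j.2 hlt x hx y hy
    · have := hpw j i j.2 i.2 hlt y hy x hx
      exact ⟨this.1.symm, fun hadj => this.2 hadj.symm⟩
  have hmem : ∀ i : Fin L.length, L.get i ∈ L := fun i => List.get_mem L i
  have e : {x | ∃ P ∈ L, x ∈ P.1} = ⋃ i : Fin L.length, (L.get i).1 := by
    ext x
    simp only [Set.mem_ofPred_eq, Set.mem_iUnion]
    constructor
    · rintro ⟨P, hP, hx⟩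
      obtain ⟨i, rfl⟩ := List.mem_iff_get.1 hP
      exact ⟨i, hx⟩
    · rintro ⟨i, hx⟩
      exact ⟨_, hmem i, hx⟩
  rw [e]
  exact .join L.length hL (fun i => (L.get i).1) (fun i => (L.get i).2) w
    (fun i => (h _ (hmem i)).1)
    (fun i j hij => Set.disjoint_left.2 fun x hx hx' => (hne i j hij x hx x hx').1 rfl)
    (fun i j hij x hx y hy => (hne i j hij x hx y hy).2)
    (fun i => (h _ (hmem i)).2.1) (fun i => (h _ (hmem i)).2.2.1)
    (fun i => (h _ (hmem i)).2.2.2)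

namespace Forest

/-- A tree with root `v` and child `w` is the join at `w` of the single vertex `v` and the trees
below `w`. There are at least two of these pieces as `k ≥ 1`, and `v` remains a leaf. -/
theorem Alt.isTreeOfStarsOn_parts {G : SimpleGraph V} {k K : ℕ} (hk : 1 ≤ k) {f : Forest V}
    (h : Alt k K f) : ∀ {p : V}, Emb G p f →
    ∀ P ∈ f.parts, IsTreeOfStarsOn G P.1 ∧ IsLeafOn G P.1 P.2 := by
  induction h with
  | empty => simp [parts]
  | @leaf v s _ ih =>
    intro p ⟨h1, h2, h3, h4, h5, h6, h7, h8⟩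
    rw [parts, List.forall_mem_cons]
    refine ⟨?_, ih h8⟩
    have e : {x | x ∈ v ::ₘ (nil : Forest V).labels} = {v} := by ext; simp
    simp only [e]
    refine ⟨.single v, rfl, ?_⟩
    rw [show G.neighborSet v ∩ {v} = ∅ by ext x; simp]
    simp
  | @step v w g s hg1 _ hg _ ihg ihs =>
    intro p ⟨h1, h2, h3, h4, h5, h6, h7, h8⟩
    rw [parts, List.forall_mem_cons]
    refine ⟨?_, ihs h8⟩
    obtain ⟨e1, e2, -, -, e5, -, e7, -⟩ := h7
    have hvw : v ≠ w := e1.ne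
    have hvg : v ∉ g.labels := fun h => h2 (by simp [h])
    have e : {x | x ∈ v ::ₘ (cons w g nil).labels}
        = insert w {x | ∃ P ∈ ({v}, v) :: g.parts, x ∈ P.1} := by
      ext x
      simp only [labels_cons, labels_nil, add_zero, Multiset.mem_cons, Set.mem_ofPred_eq,
        Set.mem_insert_iff, List.mem_cons, exists_eq_or_imp, mem_parts_iff,
        Set.mem_singleton_iff]
      tauto
    refine ⟨?_, ?_, ?_⟩
    · simp only [e]
      refine isTreeOfStarsOn_join (by simp [length_parts]; omega) ?_ ?_
      · rw [List.forall_mem_cons]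
        refine ⟨⟨.single v, ⟨rfl, ?_⟩, by simpa using hvw.symm, ?_⟩, fun P hP => ?_⟩
        · rw [show G.neighborSet v ∩ {v} = ∅ by ext x; simp]
          simp
        · rintro x rfl
          exact ⟨fun _ => rfl, fun _ => e1.symm⟩
        · obtain ⟨i1, i2⟩ := ihg e7 P hP
          exact ⟨i1, i2, fun hw => e2 (mem_parts_iff.1 ⟨P, hP, hw⟩),
            e7.adj_iff_of_mem_parts P hP⟩
      · refine List.Pairwise.cons ?_ e7.pairwise_parts
        rintro Q hQ x rfl y hy
        have hy' : y ∈ g.labels := mem_parts_iff.1 ⟨Q, hQ, hy⟩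
        exact ⟨by rintro rfl; exact hvg hy', e5 y hy'⟩
    · simp
    · refine (Set.ncard_le_ncard (t := {w}) ?_ (Set.finite_singleton w)).trans
        (Set.ncard_singleton w).le
      rintro x ⟨hx, hx'⟩
      simp only [labels_cons, labels_nil, add_zero, Multiset.mem_cons, Set.mem_ofPred_eq] at hx'
      rcases hx' with rfl | rfl | hx'
      · exact absurd rfl hx.ne
      · rfl
      · exact absurd hx (e5 x hx')

theorem Alt.exists_path : ∀ {g : Forest V}, Alt 1 1 g → g.len = 1 → ∀ p : V,
    ∃ L : List V, Odd L.length ∧ g.labels = L ∧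
      g.edges p = (List.zipWith (fun x y => s(x, y)) (p :: L) L : List (Sym2 V))
  | _, .leaf v (s := nil) _, _, p => ⟨[v], by simp, by simp, by simp⟩
  | _, .leaf v (s := cons _ _ _) _, hlen, _ => by simp at hlen
  | _, .step v w (s := nil) h1 h2 hg _, _, p => by
    obtain ⟨L, hL, hL1, hL2⟩ := hg.exists_path (by omega) w
    refine ⟨v :: w :: L, by simpa [Nat.odd_add_one] using hL, by simp [hL1], ?_⟩
    simp only [edges_cons, hL2, edges_nil, add_zero, List.zipWith_cons_cons, Multiset.cons_coe]
  | _, .step v w (s := cons _ _ _) _ _ _ _, hlen, _ => by simp at hlen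

end Forest

namespace Represents

open Forest

variable {T : SimpleGraph V} {r : V} {f : Forest V}

theorem isTreeOfStars (h : Represents T r f) {k K : ℕ} (hk : 1 ≤ k) (hf : Alt k K f)
    (hlen : 2 ≤ f.len) : IsTreeOfStars T := by
  have hr : r ∉ f.labels := (Multiset.nodup_cons.1 h.nodup).1
  have e : (Set.univ : Set V) = insert r {x | ∃ P ∈ f.parts, x ∈ P.1} := by
    symm
    refine Set.eq_univ_of_forall fun x => ?_
    rw [Set.mem_insert_iff, Set.mem_ofPred_eq, mem_parts_iff]
    exact Multiset.mem_cons.1 (h.mem x)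
  rw [IsTreeOfStars, e]
  refine isTreeOfStarsOn_join (by rwa [length_parts]) (fun P hP => ?_) h.emb.pairwise_parts
  obtain ⟨h1, h2⟩ := hf.isTreeOfStarsOn_parts hk h.emb P hP
  exact ⟨h1, h2, fun hx => hr (mem_parts_iff.1 ⟨P, hP, hx⟩), h.emb.adj_iff_of_mem_parts P hP⟩

theorem isOddPath (h : Represents T r f) (hf : Alt 1 1 f) (hlen : f.len = 1) : IsOddPath T := by
  obtain ⟨L, hL, hL1, hL2⟩ := hf.exists_path hlen r
  have hnd : (r :: L).Nodup := by
    have := h.nodup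
    rwa [hL1, Multiset.cons_coe, Multiset.coe_nodup] at this
  have hmem : ∀ x, x ∈ r :: L := by
    intro x
    have := h.mem x
    rwa [hL1, Multiset.cons_coe, Multiset.mem_coe] at this
  refine ⟨L.length, hL, ⟨SimpleGraph.Iso.symm ⟨Equiv.ofBijective (r :: L).get
    ⟨List.nodup_iff_injective_get.1 hnd, fun x => List.mem_iff_get.1 (hmem x)⟩, ?_⟩⟩⟩
  intro i j
  have key : T.Adj ((r :: L).get i) ((r :: L).get j) ↔
      ∃ (m : ℕ) (hm : m < L.length), s((r :: L)[m]'(by simp; omega), L[m])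
        = s((r :: L).get i, (r :: L).get j) := by
    rw [h.adj, hL2, Multiset.mem_coe, List.mem_iff_getElem]
    simp only [List.getElem_zipWith, List.length_zipWith, List.length_cons]
    constructor
    · rintro ⟨m, hm, he⟩
      exact ⟨m, by omega, he⟩
    · rintro ⟨m, hm, he⟩
      exact ⟨m, by omega, he⟩
  have hinj : ∀ (m : ℕ) (hm : m < (r :: L).length) (i : Fin (r :: L).length),
      (r :: L)[m] = (r :: L).get i ↔ m = i := by
    intro m hm i
    rw [List.get_eq_getElem, hnd.getElem_inj_iff]
  change T.Adj ((r :: L).get i) ((r :: L).get j) ↔ _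
  rw [key, SimpleGraph.pathGraph_adj]
  have hsucc : ∀ (m : ℕ) (hm : m < L.length), L[m] = (r :: L)[m + 1]'(by simpa using hm) :=
    fun m hm => by simp
  have hi := i.2
  have hj := j.2
  replace hi : (i : ℕ) < L.length + 1 := hi
  replace hj : (j : ℕ) < L.length + 1 := hj
  constructor
  · rintro ⟨m, hm, he⟩
    rw [Sym2.eq_iff, hsucc, hinj, hinj, hinj, hinj] at he
    omega
  · rintro (hij | hij)
    · refine ⟨i, by omega, ?_⟩
      rw [Sym2.eq_iff, hsucc]
      exact Or.inl ⟨(hinj _ _ _).2 rfl, (hinj _ _ _).2 hij⟩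
    · refine ⟨j, by omega, ?_⟩
      rw [Sym2.eq_iff, hsucc]
      exact Or.inr ⟨(hinj _ _ _).2 rfl, (hinj _ _ _).2 hij⟩

theorem ncard_neighborSet [DecidableEq V] (h : Represents T r f) (x : V) :
    (T.neighborSet x).ncard = (f.edges r).countP (x ∈ ·) := by
  have hinj : Set.InjOn (fun y => s(x, y)) (T.neighborSet x) := fun y _ z _ hyz => by
    exact Sym2.congr_right.1 hyz
  have e : (fun y => s(x, y)) '' T.neighborSet x
      = (((f.edges r).filter (x ∈ ·)).toFinset : Set (Sym2 V)) := by
    ext e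
    simp only [Set.mem_image, SimpleGraph.mem_neighborSet, h.adj, Multiset.toFinset_filter,
      Finset.coe_filter, Multiset.mem_toFinset, Set.mem_ofPred_eq]
    constructor
    · rintro ⟨y, hy, rfl⟩
      exact ⟨hy, Sym2.mem_mk_left _ _⟩
    · rintro ⟨he, y, rfl⟩
      exact ⟨y, he, rfl⟩
  rw [← hinj.ncard_image, e, Set.ncard_coe_finset,
    Multiset.toFinset_card_of_nodup (h.edges_nodup.filter _), Multiset.countP_eq_card_filter]

end Represents

end StableTree

/-! ### The partition into stars and its uniqueness. -/

namespace StableTree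

variable {V : Type*}

/-- The colour class `C` of the tree `T` has `n - α` vertices, their degrees are `m` or `m + 1`, and
all other vertices have degree at most `2`. -/
structure IsCenterClass (T : SimpleGraph V) (C : Set V) (m : ℕ) : Prop where
  isTree : T.IsTree
  mem_iff : ∀ x y, T.Adj x y → (x ∈ C ↔ y ∉ C)
  card : C.ncard + T.indepNum = Nat.card V
  degree_le_two : ∀ x, x ∉ C → (T.neighborSet x).ncard ≤ 2
  le_degree : ∀ x ∈ C, m ≤ (T.neighborSet x).ncard
  degree_le : ∀ x ∈ C, (T.neighborSet x).ncard ≤ m + 1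
  pos : 0 < m

theorem ncard_incidenceSet (T : SimpleGraph V) (x : V) :
    (T.incidenceSet x).ncard = (T.neighborSet x).ncard := by
  have hinj : Set.InjOn (fun y => s(x, y)) (T.neighborSet x) := fun y _ z _ hyz =>
    Sym2.congr_right.1 hyz
  rw [← hinj.ncard_image]
  congr 1
  ext e
  constructor
  · rintro ⟨he, y, rfl⟩
    exact ⟨y, he, rfl⟩
  · rintro ⟨y, hy, rfl⟩
    exact ⟨hy, Sym2.mem_mk_left _ _⟩

theorem adj_of_mem_edge {T : SimpleGraph V} {e : Sym2 V} (he : e ∈ T.edgeSet) {x y : V}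
    (hx : x ∈ e) (hy : y ∈ e) (hxy : x ≠ y) : T.Adj x y := by
  rwa [(Sym2.mem_and_mem_iff hxy).1 ⟨hx, hy⟩] at he

namespace IsCenterClass

variable {T : SimpleGraph V} {C : Set V} {m : ℕ}

theorem eq_of_mem (h : IsCenterClass T C m) {e : Sym2 V} (he : e ∈ T.edgeSet) {x y : V}
    (hx : x ∈ e) (hy : y ∈ e) (hxC : x ∈ C) (hyC : y ∈ C) : x = y := by
  by_contra hxy
  exact (h.mem_iff x y (adj_of_mem_edge he hx hy hxy)).1 hxC hyC

theorem exists_mem (h : IsCenterClass T C m) {e : Sym2 V} (he : e ∈ T.edgeSet) :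
    ∃ x ∈ C, x ∈ e := by
  induction e with
  | h x y =>
    have := h.mem_iff x y he
    by_cases hx : x ∈ C
    · exact ⟨x, hx, Sym2.mem_mk_left _ _⟩
    · exact ⟨y, by tauto, Sym2.mem_mk_right _ _⟩

theorem sum_degree [Finite V] (h : IsCenterClass T C m) :
    ∃ S : Finset V, (S : Set V) = C ∧ S.card = C.ncard ∧
      ∑ x ∈ S, (T.neighborSet x).ncard + 1 = Nat.card V := by
  classical
  let := Fintype.ofFinite V
  have hb : T.IsBipartiteWith (C.toFinset : Set V) (Cᶜ.toFinset : Set V) := by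
    simp only [Set.coe_toFinset]
    refine ⟨disjoint_compl_right, fun x y hxy => ?_⟩
    have := h.mem_iff x y hxy
    simp only [Set.mem_compl_iff]
    tauto
  have hs := SimpleGraph.isBipartiteWith_sum_degrees_eq_card_edges hb
  have hd : ∀ x, T.degree x = (T.neighborSet x).ncard := fun x => by
    rw [Set.ncard_eq_toFinset_card', SimpleGraph.degree, SimpleGraph.neighborFinset]
  simp only [hd] at hs
  refine ⟨C.toFinset, by simp, by rw [Set.ncard_eq_toFinset_card'], ?_⟩
  rw [hs, h.isTree.card_edgeFinset, Nat.card_eq_fintype_card]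

theorem injOn_incidenceSet [Finite V] (h : IsCenterClass T C m) :
    Set.InjOn T.incidenceSet C := by
  intro x hx y hy hxy
  have h1 : (T.incidenceSet x).ncard ≠ 0 := by
    rw [ncard_incidenceSet]
    have := h.le_degree x hx
    have := h.pos
    omega
  obtain ⟨e, he⟩ := Set.nonempty_of_ncard_ne_zero h1
  have he' : e ∈ T.incidenceSet y := hxy ▸ he
  exact h.eq_of_mem he.1 he.2 he'.2 hx hy

/-- The quotient is the average degree over `C`, since every edge has exactly one end in `C`. All
these degrees are `m` or `m + 1`, so a degree `m` is the floor and a degree `m + 1` the ceiling of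
the average. -/
theorem ncard_eq_ceil_or_floor [Finite V] (h : IsCenterClass T C m) {x : V} (hx : x ∈ C) :
    ((T.neighborSet x).ncard : ℤ)
        = ⌈((Nat.card V : ℚ) - 1) / ((Nat.card V : ℚ) - (T.indepNum : ℚ))⌉ ∨
      ((T.neighborSet x).ncard : ℤ)
        = ⌊((Nat.card V : ℚ) - 1) / ((Nat.card V : ℚ) - (T.indepNum : ℚ))⌋ := by
  obtain ⟨S, hSC, hcard, hsum⟩ := h.sum_degree
  have hxS : x ∈ S := by rw [← Finset.mem_coe, hSC]; exact hx
  have hmem : ∀ y ∈ S, y ∈ C := fun y hy => by rw [← hSC]; exact hy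
  have hpos : (0 : ℚ) < S.card := by exact_mod_cast Finset.card_pos.2 ⟨x, hxS⟩
  have h1 := h.card
  rw [← hcard] at h1
  have e1 : (Nat.card V : ℚ) - (T.indepNum : ℚ) = S.card := by rw [← h1]; push_cast; ring
  have e2 : (Nat.card V : ℚ) - 1 = ((∑ y ∈ S, (T.neighborSet y).ncard : ℕ) : ℚ) := by
    rw [← hsum]; push_cast; ring
  rw [e1, e2]
  have hlow : S.card * m ≤ ∑ y ∈ S, (T.neighborSet y).ncard := by
    rw [← smul_eq_mul]
    exact Finset.card_nsmul_le_sum _ _ _ fun y hy => h.le_degree y (hmem y hy)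
  have hup : ∑ y ∈ S, (T.neighborSet y).ncard ≤ S.card * (m + 1) := by
    rw [← smul_eq_mul]
    exact Finset.sum_le_card_nsmul _ _ _ fun y hy => h.degree_le y (hmem y hy)
  rcases (h.le_degree x hx).eq_or_lt with hm | hm
  · right
    have hlt : ∑ y ∈ S, (T.neighborSet y).ncard < S.card * (m + 1) := by
      rw [← smul_eq_mul, ← Finset.sum_const]
      exact Finset.sum_lt_sum (fun y hy => h.degree_le y (hmem y hy)) ⟨x, hxS, by omega⟩
    rw [← hm, eq_comm, Int.floor_eq_iff, le_div_iff₀ hpos, div_lt_iff₀ hpos]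
    constructor
    · rw [mul_comm]; exact_mod_cast hlow
    · rw [mul_comm]; exact_mod_cast hlt
  · left
    have hlt : S.card * m < ∑ y ∈ S, (T.neighborSet y).ncard := by
      rw [← smul_eq_mul, ← Finset.sum_const]
      exact Finset.sum_lt_sum (fun y hy => h.le_degree y (hmem y hy)) ⟨x, hxS, hm⟩
    have hm' : (T.neighborSet x).ncard = m + 1 := le_antisymm (h.degree_le x hx) hm
    rw [hm', eq_comm, Int.ceil_eq_iff, lt_div_iff₀ hpos, div_le_iff₀ hpos]
    constructor
    · push_cast
      rw [add_sub_cancel_right, mul_comm]; exact_mod_cast hlt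
    · rw [mul_comm]; exact_mod_cast hup

theorem isBalancedStarPartition [Finite V] (h : IsCenterClass T C m) :
    IsBalancedStarPartition T (T.incidenceSet '' C) where
  cover := by
    ext e
    constructor
    · rintro ⟨-, ⟨x, -, rfl⟩, he⟩
      exact he.1
    · intro he
      obtain ⟨x, hx, hxe⟩ := h.exists_mem he
      exact ⟨_, ⟨x, hx, rfl⟩, he, hxe⟩
  disjoint := by
    rintro - ⟨x, hx, rfl⟩ - ⟨y, hy, rfl⟩ hne
    refine Set.disjoint_left.2 fun e he he' => hne ?_
    rw [h.eq_of_mem he.1 he.2 he'.2 hx hy]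
  count := by
    rw [h.injOn_incidenceSet.ncard_image, ← h.card]
    push_cast; ring
  size := by
    rintro - ⟨x, hx, rfl⟩
    rw [ncard_incidenceSet]
    exact h.ncard_eq_ceil_or_floor hx
  atMostTwo := by
    intro v
    by_cases hv : v ∈ C
    · refine (Set.ncard_le_ncard (t := {T.incidenceSet v}) ?_ (Set.finite_singleton _)).trans
        (by rw [Set.ncard_singleton]; omega)
      rintro - ⟨⟨x, hx, rfl⟩, e, he, hve⟩
      rw [Set.mem_singleton_iff, h.eq_of_mem he.1 he.2 hve hx hv]
    · refine (Set.ncard_le_ncard (t := T.incidenceSet '' T.neighborSet v) ?_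
        (Set.toFinite _)).trans ((Set.ncard_image_le (Set.toFinite _)).trans
          (h.degree_le_two v hv))
      rintro - ⟨⟨x, hx, rfl⟩, e, he, hve⟩
      exact ⟨x, adj_of_mem_edge he.1 hve he.2 (by rintro rfl; exact hv hx), rfl⟩
  centers := by
    have : Nonempty V := h.isTree.connected.nonempty
    have hl := h.injOn_incidenceSet.leftInvOn_invFunOn
    refine ⟨Function.invFunOn T.incidenceSet C, ?_, ?_⟩
    · rintro - ⟨x, hx, rfl⟩
      rw [hl hx]
      refine ⟨Set.nonempty_of_ncard_ne_zero ?_, fun e he => he.2⟩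
      rw [ncard_incidenceSet]
      have := h.le_degree x hx
      have := h.pos
      omega
    · rintro - ⟨-, ⟨x, hx, rfl⟩, rfl⟩ - ⟨-, ⟨y, hy, rfl⟩, rfl⟩ -
      rw [hl hx, hl hy]
      exact fun hadj => (h.mem_iff x y hadj).1 hx hy

/-- The star centers are stable and meet every edge, so they form a colour class of the connected
graph `T`. Once this class is `C`, the centers are distinct by counting, and each star consists of
all edges at its center. -/
theorem eq_of_isBalancedStarPartition [Finite V] (h : IsCenterClass T C m)
    (h2 : ∀ x ∈ C, 2 ≤ (T.neighborSet x).ncard) {P : Set (Set (Sym2 V))}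
    (hP : IsBalancedStarPartition T P) : P = T.incidenceSet '' C := by
  obtain ⟨c, hstar, hind⟩ := hP.centers
  have hedge : ∀ e ∈ T.edgeSet, ∃ E ∈ P, e ∈ E := fun e he => by
    rw [← hP.cover] at he; exact he
  have hbip : ∀ x y, T.Adj x y → (x ∈ c '' P ↔ y ∉ c '' P) := by
    intro x y hxy
    constructor
    · exact fun hx hy => hind hx hy hxy.ne hxy
    · intro hy
      obtain ⟨E, hE, he⟩ := hedge s(x, y) hxy
      rcases Sym2.mem_iff.1 ((hstar E hE).2 _ he) with h1 | h1
      · exact ⟨E, hE, h1⟩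
      · exact absurd ⟨E, hE, h1⟩ hy
  have hsame : ∀ {x y}, T.Walk x y → ((x ∈ C ↔ x ∈ c '' P) ↔ (y ∈ C ↔ y ∈ c '' P)) := by
    intro x y w
    induction w with
    | nil => rfl
    | cons hadj _ ih =>
      rw [← ih]
      have h1 := h.mem_iff _ _ hadj
      have h2 := hbip _ _ hadj
      tauto
  have hcardP : P.ncard = C.ncard := by
    have h1 := hP.count
    have h2 := h.card
    omega
  have hle : (c '' P).ncard ≤ P.ncard := Set.ncard_image_le (Set.toFinite _)
  have hCC : c '' P = C := by
    obtain ⟨r⟩ := h.isTree.connected.nonempty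
    by_cases hr : r ∈ C ↔ r ∈ c '' P
    · ext x
      obtain ⟨w⟩ := h.isTree.connected.preconnected r x
      exact ((hsame w).1 hr).symm
    -- Otherwise the centers are the complement of `C`, so `C` contains at least half of the
    -- vertices, whereas degrees at least 2 on `C` force `2 * C.ncard ≤ n - 1`.
    · exfalso
      have hcompl : c '' P = Cᶜ := by
        ext x
        obtain ⟨w⟩ := h.isTree.connected.preconnected r x
        have := mt (hsame w).2 hr
        rw [Set.mem_compl_iff]
        tauto
      rw [hcompl, hcardP] at hle
      obtain ⟨S, hSC, hcard, hsum⟩ := h.sum_degree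
      have h3 : S.card * 2 ≤ ∑ y ∈ S, (T.neighborSet y).ncard := by
        rw [← smul_eq_mul]
        exact Finset.card_nsmul_le_sum _ _ _ fun y hy => h2 y (by rw [← hSC]; exact hy)
      have h4 := Set.ncard_add_ncard_compl C
      omega
  have hinj : Set.InjOn c P := (Set.ncard_image_iff (Set.toFinite P)).1 (by rw [hCC, hcardP])
  have hE : ∀ E ∈ P, E = T.incidenceSet (c E) := by
    intro E hE
    ext e
    constructor
    · intro he
      exact ⟨by rw [← hP.cover]; exact ⟨E, hE, he⟩, (hstar E hE).2 e he⟩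
    · rintro ⟨he, hce⟩
      obtain ⟨E', hE', he'⟩ := hedge e he
      have h1 : c E ∈ C := hCC ▸ ⟨E, hE, rfl⟩
      have h2 : c E' ∈ C := hCC ▸ ⟨E', hE', rfl⟩
      rwa [hinj hE hE' (h.eq_of_mem he hce ((hstar E' hE').2 e he') h1 h2)]
  ext E
  constructor
  · intro h1
    exact ⟨c E, hCC ▸ ⟨E, h1, rfl⟩, (hE E h1).symm⟩
  · rintro ⟨x, hx, rfl⟩
    rw [← hCC] at hx
    obtain ⟨E, h1, rfl⟩ := hx
    rwa [← hE E h1]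

/-- Vertices of `C` have degree at least 2, so a leaf lies outside `C`, and a vertex at odd distance
from it has the other colour. -/
theorem mem_of_isCenter [Finite V] (h : IsCenterClass T C m) [Nontrivial V]
    (h2 : ∀ x ∈ C, 2 ≤ (T.neighborSet x).ncard) {u : V} (hu : IsCenter T u) : u ∈ C := by
  classical
  let := Fintype.ofFinite V
  obtain ⟨x, hx⟩ := h.isTree.exists_vert_degree_one_of_nontrivial
  have hx' : (T.neighborSet x).ncard = 1 := by
    rw [← hx, Set.ncard_eq_toFinset_card', SimpleGraph.degree, SimpleGraph.neighborFinset]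
  have hxC : x ∉ C := fun hxC => by have := h2 x hxC; omega
  have hodd := hu x hx'.le
  obtain ⟨w, hw⟩ := h.isTree.connected.exists_walk_length_eq_dist u x
  let col : T.Coloring Bool := SimpleGraph.Coloring.mk (fun y => decide (y ∈ C)) fun {y z} hyz => by
    have := h.mem_iff y z hyz
    by_cases hy : y ∈ C <;> by_cases hz : z ∈ C <;> simp_all
  by_contra huC
  rw [← hw, ← Nat.not_even_iff_odd, col.even_length_iff_congr w] at hodd
  refine hodd ?_
  change decide (u ∈ C) = true ↔ decide (x ∈ C) = true
  simp [huC, hxC]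

end IsCenterClass

open Forest

theorem Represents.isCenterClass {T : SimpleGraph V} {r : V} {f : Forest V}
    (h : Represents T r f) {k K m : ℕ} (hk : 1 ≤ k) (hf : Alt k K f) (hm : 0 < m)
    (hmk : m ≤ k + 1) (hKm : K ≤ m) (hlen : m ≤ f.len) (hlen' : f.len ≤ m + 1) :
    IsCenterClass T {x | x ∈ r ::ₘ f.oddDepth} m ∧
      (2 ≤ f.len → ∀ x ∈ r ::ₘ f.oddDepth, 2 ≤ (T.neighborSet x).ncard) := by
  classical
  have hn := h.nodup
  have hr := (Multiset.nodup_cons.1 hn).1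
  have hn' := (Multiset.nodup_cons.1 hn).2
  rw [← evenDepth_add_oddDepth, Multiset.nodup_add] at hn'
  have hd : ∀ x ∈ f.evenDepth, x ∉ r ::ₘ f.oddDepth := by
    intro x hx hx'
    rcases Multiset.mem_cons.1 hx' with rfl | hx'
    · exact hr (mem_labels_iff.2 (Or.inl hx))
    · exact Multiset.disjoint_left.1 hn'.2.2 hx hx'
  have hdeg := hf.countP_edges hn
  have hfnil : f ≠ nil := by rintro rfl; simp at hlen; omega
  have hodd : ∀ x ∈ f.oddDepth, k + 1 ≤ (T.neighborSet x).ncard ∧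
      (T.neighborSet x).ncard ≤ K + 1 := fun x hx => by
    rw [h.ncard_neighborSet]; exact hdeg.2 x hx
  have hroot : (T.neighborSet r).ncard = f.len := by
    rw [h.ncard_neighborSet, countP_edges_root hr]
  refine ⟨⟨h.isTree, ?_, ?_, ?_, ?_, ?_, hm⟩, ?_⟩
  · intro x y hxy
    simp only [Set.mem_ofPred_eq]
    rcases mem_levels_of_mem_edges ((h.adj x y).1 hxy) with ⟨h1, h2⟩ | ⟨h1, h2⟩
    · have := hd x h1; tauto
    · have := hd y h1; tauto
  · have hno : (r ::ₘ f.oddDepth).Nodup :=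
      Multiset.nodup_cons.2 ⟨fun hx => hr (mem_labels_iff.2 (Or.inr hx)), hn'.2.1⟩
    have e : {x | x ∈ r ::ₘ f.oddDepth} = ((r ::ₘ f.oddDepth).toFinset : Set V) := by
      ext; simp
    rw [e, Set.ncard_coe_finset, Multiset.toFinset_card_of_nodup hno, h.indepNum_eq, h.card_eq,
      ← evenDepth_add_oddDepth]
    simp [hf.hasE hk hfnil, hf.card_evenDepth hk]
    ring
  · intro x hx
    have : x ∈ f.evenDepth := by
      have h1 := h.mem x
      rw [Multiset.mem_cons, mem_labels_iff] at h1
      rw [Set.mem_ofPred_eq, Multiset.mem_cons] at hx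
      tauto
    rw [h.ncard_neighborSet]
    exact hdeg.1 x this
  · intro x hx
    rcases Multiset.mem_cons.1 hx with rfl | hx
    · rwa [hroot]
    · exact hmk.trans (hodd x hx).1
  · intro x hx
    rcases Multiset.mem_cons.1 hx with rfl | hx
    · rwa [hroot]
    · exact (hodd x hx).2.trans (by omega)
  · intro hl x hx
    rcases Multiset.mem_cons.1 hx with rfl | hx
    · rwa [hroot]
    · have := (hodd x hx).1; omega

theorem isBalancedTreeOfStars_of_subsingleton [Subsingleton V] (T : SimpleGraph V) (v : V) :
    IsBalancedTreeOfStars T := by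
  refine ⟨?_, fun u w _ _ => ?_⟩
  · rw [IsTreeOfStars, show (Set.univ : Set V) = {v} from
      (Set.eq_univ_of_forall fun x => Subsingleton.elim x v).symm]
    exact .single v
  · rw [Subsingleton.elim u w]; omega

end StableTree

/-! ### Assembly. -/

open StableTree Forest in
theorem theorem2 {V : Type*} [Finite V] (T : SimpleGraph V)
    (hT : StableTree.IsExtremalTree T) :
    (StableTree.IsBalancedTreeOfStars T ∨ StableTree.IsOddPath T) ∧
    (2 ≤ Nat.card V → ∃ P, StableTree.IsBalancedStarPartition T P) ∧
    (2 ≤ Nat.card V → ¬ StableTree.IsOddPath T →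
      ∃! P, StableTree.IsBalancedStarPartition T P) := by
  obtain ⟨r⟩ := hT.1.connected.nonempty
  rcases subsingleton_or_nontrivial V with hV | hV
  · have h1 : Nat.card V = 1 := Nat.card_eq_one_iff_unique.2 ⟨hV, ⟨r⟩⟩
    exact ⟨Or.inl (isBalancedTreeOfStars_of_subsingleton T r), fun h => by omega,
      fun h => by omega⟩
  · obtain ⟨f, hf⟩ := exists_represents hT.1 r
    have hfn : f ≠ nil := by
      rintro rfl
      have h1 := hf.card_eq
      have h2 := Finite.one_lt_card (α := V)
      simp at h1
      omega
    obtain ⟨a, g, j, hs, halt, hlen⟩ := (hT.opt hf).exists_alt hfn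
    have hg := hf.congr hs
    have hk : 1 ≤ max j 1 := le_max_right _ _
    have hj : j ≤ max j 1 := le_max_left _ _
    -- A center other than the root has one more neighbour than children, so its degree is `j + 1`
    -- or `j + 2`; the root has degree `j + 2`, or `1` if `j = 0` and the tree is an odd path.
    obtain ⟨hC, hC2⟩ := hg.isCenterClass hk halt (m := j + 1) (by omega) (by omega) le_rfl
      (by omega) (by omega)
    rcases hlen with ⟨hlen, rfl⟩ | hlen
    · have hodd : IsOddPath T := hg.isOddPath halt hlen
      exact ⟨Or.inr hodd, fun _ => ⟨_, hC.isBalancedStarPartition⟩, fun _ h => absurd hodd h⟩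
    · have h2 := hC2 (by omega)
      refine ⟨Or.inl ⟨hg.isTreeOfStars hk halt (by omega), fun u v hu hv => ?_⟩,
        fun _ => ⟨_, hC.isBalancedStarPartition⟩, fun _ _ => ⟨_, hC.isBalancedStarPartition,
          fun P hP => hC.eq_of_isBalancedStarPartition h2 hP⟩⟩
      exact (hC.degree_le u (hC.mem_of_isCenter h2 hu)).trans
        (Nat.add_le_add_right (hC.le_degree v (hC.mem_of_isCenter h2 hv)) 1)
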